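/- Consider $K$ polygons (disks), numbered $1,\dots,K$, each with at least one point (vertex) marked on its boundary circle; polygons with one or two vertices are allowed. The marked points divide the boundary circles into sides, $2N$ in total, and in each polygon one side is distinguished. A gluing of the polygons is a splitting of the $2N$ sides into $N$ pairs, the two sides of each pair being glued together with opposite orientations; the result is a compact orientable surface without boundary carrying an embedded graph with $N$ edges and $K$ faces. For $N\ge 1$ let $\varepsilon_g(N,K)$ be the number of gluings (over all distributions of the $2N$ sides among the $K$ polygons) for which this surface is connected and has genus $g$, where the genus is given by Euler's formula $V-N+K=2-2g$ with $V$ the number of vertices of the graph; gluings are counted up to orientation-preserving isomorphism respecting the numbers of the polygons and the distinguished sides. Theorem. For every $N\ge 1$, the number of gluings of two polygons with $2N$ sides in total into a torus is $$\varepsilon_1(N,2)=4^{N-4}\,\frac{N(N-1)(N-2)(13N+3)}{3}.$$ -/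

import Mathlib

/-- A gluing of `K` numbered polygons with `2 * N` sides in total.

The `i`-th polygon is a disk with `sides i ≥ 1` points marked on its boundary circle. Going
counterclockwise from its distinguished side, its sides are numbered `0, 1, …, sides i - 1`, so the
distinguished side is number `0`. The sides of all polygons are split into pairs: `glue` sends each
side to its partner, to which it is glued with the opposite orientation. An isomorphism of such
data that preserves the orientation, the numbers of the polygons and the distinguished sides
preserves the number of every side, so distinct terms are pairwise non-isomorphic gluings. -/
structure PolygonGluing (N K : ℕ) where
  /-- the number of sides of each polygon -/
  sides : Fin K → ℕ
  sides_pos : ∀ i, 0 < sides i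
  sum_sides : ∑ i, sides i = 2 * N
  /-- the pairing of the sides -/
  glue : Equiv.Perm (Σ i, Fin (sides i))
  glue_glue : ∀ e, glue (glue e) = e
  glue_ne : ∀ e, glue e ≠ e

namespace PolygonGluing

variable {N K : ℕ} (P : PolygonGluing N K)

/-- The sides of the polygons: `⟨i, j⟩` is side number `j` of polygon number `i`. -/
abbrev Side : Type := Σ i, Fin (P.sides i)

/-- The marked points of the polygons before gluing; `⟨i, j⟩` is the point of polygon `i` at which
its side number `j` begins. -/
abbrev Corner : Type := Σ i, Fin (P.sides i)

/-- The first point of a side, in the counterclockwise orientation of its polygon. -/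
def first (e : P.Side) : P.Corner := e

/-- The last point of a side, in the counterclockwise orientation of its polygon: the next corner
of the same polygon, cyclically. -/
def last (e : P.Side) : P.Corner := ⟨e.1, finRotate (P.sides e.1) e.2⟩

/-- The identifications of corners made by the gluing: as partners are oppositely oriented, the
first point of a side is glued to the last point of its partner, and its last point to the first
point of its partner. -/
def CornerGlued (c d : P.Corner) : Prop :=
  ∃ e : P.Side, (c = P.first e ∧ d = P.last (P.glue e)) ∨
    (c = P.last e ∧ d = P.first (P.glue e))

/-- The vertices of the graph drawn on the glued surface: the corners modulo the equivalence
relation generated by the identifications. -/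
def Vertex : Type := Quot P.CornerGlued

/-- The adjacency graph of the polygons: two different polygons are adjacent when some side of one
is glued to some side of the other. -/
def polygonGraph : SimpleGraph (Fin K) :=
  SimpleGraph.fromRel fun i j => ∃ e : P.Side, e.1 = i ∧ (P.glue e).1 = j

/-- The glued surface is connected: polygons are attached to each other along sides only, so this
means that the adjacency graph of the polygons is connected. -/
def IsConnected : Prop := P.polygonGraph.Connected

/-- The Euler characteristic of the glued surface, from its cell structure with the above vertices,
`N` edges (the pairs of glued sides) and `K` faces (the polygons). -/
noncomputable def eulerChar : ℤ := (Nat.card P.Vertex : ℤ) - N + K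

/-- The glued surface is connected and has genus `g`. It is closed and orientable in any case, so
its genus is given by Euler's formula. -/
def HasGenus (g : ℕ) : Prop := P.IsConnected ∧ P.eulerChar = 2 - 2 * g

/-- There are finitely many gluings, so that `Nat.card` counts them. -/
instance finite (N K : ℕ) : Finite (PolygonGluing N K) := by
  let f : PolygonGluing N K →
      Σ s : Fin K → Fin (2 * N + 1), Equiv.Perm (Σ i, Fin (s i : ℕ)) := fun P =>
    ⟨fun i => ⟨P.sides i, Nat.lt_succ_of_le
      (P.sum_sides ▸ Finset.single_le_sum (fun _ _ => Nat.zero_le _) (Finset.mem_univ i))⟩, P.glue⟩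
  refine Finite.of_injective f ?_
  rintro ⟨s, h1, h2, p, h3, h4⟩ ⟨s', h1', h2', p', h3', h4'⟩ h
  have h0 : s = s' := by
    funext i
    have := congrArg (fun x => ((x.1 i : Fin (2 * N + 1)) : ℕ)) h
    exact this
  subst h0
  have hp : p = p' := by
    simpa [f] using h
  subst hp
  rfl

end PolygonGluing

open Classical in
/-- `gluingNumber g N K` is the number of ways to glue `K` polygons with `2 * N` sides in total into
a connected orientable surface of genus `g`. For `N = 0` it is `1` by convention if `g = 0` and
`K = 1` (the sphere with a single vertex) and `0` otherwise. -/
noncomputable def gluingNumber (g N K : ℕ) : ℕ :=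
  if N = 0 then (if g = 0 ∧ K = 1 then 1 else 0)
  else Nat.card {P : PolygonGluing N K // P.HasGenus g}

/-! Number the sides, let `φ` rotate every polygon by one side and let `α` be the gluing. The
vertices are the cycles of `φ * α` (`PolygonGluing.card_vertex`). Weight a gluing with `V` vertices
by `y ^ ((N + K - V) / 2)`. The exponent is additive over connected components, and a component of
genus `g` made of `k` polygons contributes `g + k - 1`.

Fix a side `e` with partner `f`. Factoring `swap e f` out of `α` replaces `φ` by `φ * swap e f`: the
cycle through `e` splits in two if it contains `f`, and otherwise two cycles merge, at the cost of a
factor `y`. This recursion determines the weighted count of all gluings, connected or not. By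
`LoopEquations.blockSum_recursion`, the sum over partitions of the polygons into connected blocks
satisfies the same recursion once the block weights satisfy the loop equations; `GenusSum.blockSum`
concludes by induction on the number of unglued sides. Modulo `y ^ 3` only blocks of at most three
polygons occur, and a torus with two polygons is the coefficient of `y ^ 2` in the two-polygon
weight.

Each loop equation is linear in its leading unknown series `W`, of the form `W = 2 * X ^ 2 *
planarDisk * W + F`, so `W = F / √(1 - 4 * X ^ 2)`. This yields in turn the planar two-polygon,
torus one-polygon, planar three-polygon and torus two-polygon series. Summing the last over all
distributions of the sides gives `(21 * X ^ 6 + 20 * X ^ 8) / (1 - 4 * X ^ 2) ^ 5`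
(`Correlator.diagSeries_torusTwo`), whose coefficients are the claimed numbers. -/

/-- The sum of `g b L'` over all ways to remove one entry `b` from a list, `L'` being the rest. -/
def pick {R : Type*} [AddCommMonoid R] : List ℕ → (ℕ → List ℕ → R) → R
  | [], _ => 0
  | b :: L, g => g b L + pick L fun c L' => g c (b :: L')

/-- The sum of `g b c L'` over all ways to remove two entries `b`, `c` (in this order) from a list,
`L'` being the rest. -/
def pickTwo {R : Type*} [AddCommMonoid R] : List ℕ → (ℕ → ℕ → List ℕ → R) → R
  | [], _ => 0
  | b :: L, g => pick L (g b) + pickTwo L fun c d L' => g c d (b :: L')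

/-- The sum over all ways to write `n` as `j + k + 2`. -/
def splitSum {R : Type*} [AddCommMonoid R] (n : ℕ) (g : ℕ → ℕ → R) : R :=
  ∑ j ∈ Finset.range (n - 1), g j (n - 2 - j)

/-! ### Linearity of sums over removed list entries -/

section Pick

variable {R : Type*} [CommRing R]

theorem pick_congr (L : List ℕ) (g g' : ℕ → List ℕ → R)
    (h : ∀ b L', L'.length + 1 = L.length → g b L' = g' b L') : pick L g = pick L g' := by
  induction L generalizing g g' with
  | nil => rfl
  | cons a L ih =>
    simp only [pick]
    rw [h a L rfl, ih _ _ fun b L' hL => h b (a :: L') (by simp [hL])]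

theorem pickTwo_congr (L : List ℕ) (g g' : ℕ → ℕ → List ℕ → R)
    (h : ∀ b c L', L'.length + 2 = L.length → g b c L' = g' b c L') :
    pickTwo L g = pickTwo L g' := by
  induction L generalizing g g' with
  | nil => rfl
  | cons a L ih =>
    simp only [pickTwo]
    rw [pick_congr L (g a) (g' a) fun b L' hL => h a b L' (by simp [← hL]),
      ih _ _ fun b c L' hL => h b c (a :: L') (by simp [← hL])]

theorem pick_add (L : List ℕ) (g g' : ℕ → List ℕ → R) :
    pick L (fun b L' => g b L' + g' b L') = pick L g + pick L g' := by
  induction L generalizing g g' with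
  | nil => simp [pick]
  | cons a L ih => simp only [pick, ih]; ring

theorem pickTwo_add (L : List ℕ) (g g' : ℕ → ℕ → List ℕ → R) :
    pickTwo L (fun b c L' => g b c L' + g' b c L') = pickTwo L g + pickTwo L g' := by
  induction L generalizing g g' with
  | nil => simp [pickTwo]
  | cons a L ih =>
    simp only [pickTwo, ih]
    rw [show g a = fun b L' => g a b L' from rfl, show g' a = fun b L' => g' a b L' from rfl,
      pick_add]; ring

theorem mul_pick (r : R) (L : List ℕ) (g : ℕ → List ℕ → R) :
    r * pick L g = pick L (fun b L' => r * g b L') := by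
  induction L generalizing g with
  | nil => simp [pick]
  | cons a L ih => simp only [pick, mul_add, ih]

theorem mul_pickTwo (r : R) (L : List ℕ) (g : ℕ → ℕ → List ℕ → R) :
    r * pickTwo L g = pickTwo L (fun b c L' => r * g b c L') := by
  induction L generalizing g with
  | nil => simp [pickTwo]
  | cons a L ih => simp only [pickTwo, mul_add, ih, mul_pick]

theorem sum_pick {ι : Type*} (s : Finset ι) (L : List ℕ) (g : ι → ℕ → List ℕ → R) :
    ∑ i ∈ s, pick L (g i) = pick L (fun b L' => ∑ i ∈ s, g i b L') := by
  induction L generalizing g with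
  | nil => simp [pick]
  | cons a L ih => simp only [pick, Finset.sum_add_distrib, ih]

theorem sum_pickTwo {ι : Type*} (s : Finset ι) (L : List ℕ) (g : ι → ℕ → ℕ → List ℕ → R) :
    ∑ i ∈ s, pickTwo L (g i) = pickTwo L (fun b c L' => ∑ i ∈ s, g i b c L') := by
  induction L generalizing g with
  | nil => simp [pickTwo]
  | cons a L ih => simp only [pickTwo, Finset.sum_add_distrib, ih, sum_pick]

theorem pick_zero (L : List ℕ) : pick L (fun _ _ => (0 : R)) = 0 := by
  induction L with
  | nil => rfl
  | cons a L ih => simp [pick, ih]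

theorem pickTwo_zero (L : List ℕ) : pickTwo L (fun _ _ _ => (0 : R)) = 0 := by
  induction L with
  | nil => rfl
  | cons a L ih => simp [pickTwo, ih, pick_zero]

/-- Successive removals meet every pair in both orders, `pickTwo` only in the order of the list;
hence the symmetrized summand. -/
theorem pick_pick (L : List ℕ) (g : ℕ → ℕ → List ℕ → R) :
    pick L (fun b L' => pick L' (g b)) = pickTwo L (fun b c L' => g b c L' + g c b L') := by
  induction L generalizing g with
  | nil => rfl
  | cons a L ih =>
    simp only [pick, pickTwo]
    rw [pick_add L (fun b L' => g b a L') (fun b L' => pick L' fun c L'' => g b c (a :: L''))]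
    rw [ih (fun b c L'' => g b c (a :: L''))]
    rw [pick_add L (fun c L' => g a c L') (fun c L' => g c a L')]
    ring

end Pick

/-! ### Partition expansion and loop equations -/

section Expansion

variable {R : Type*} [CommRing R] (u : ℕ → R) (v : ℕ → ℕ → R) (κ : ℕ → ℕ → ℕ → R)

/-- The sum over all partitions of a list (of length at most `k`) into blocks of size at most
three, weighted by the product of the values of `u`, `v`, `κ` on the blocks. -/
def blockSumAux : ℕ → List ℕ → R
  | 0, _ => 1
  | _ + 1, [] => 1
  | k + 1, n :: L => u n * blockSumAux k L + pick L (fun b L' => v n b * blockSumAux k L') +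
      pickTwo L (fun b c L' => κ n b c * blockSumAux k L')

/-- The sum over all partitions of a list into blocks of size at most three, weighted by the
product of the values of `u`, `v`, `κ` on the blocks. -/
def blockSum (L : List ℕ) : R := blockSumAux u v κ L.length L

/-- The first argument of `blockSumAux` is only fuel for a recursion that removes entries from the
middle of the list; any sufficient amount gives the same value. -/
theorem blockSumAux_eq (k : ℕ) (L : List ℕ) (h : L.length ≤ k) :
    blockSumAux u v κ k L = blockSum u v κ L := by
  suffices H : ∀ k k' (L : List ℕ), L.length ≤ k → L.length ≤ k' →
      blockSumAux u v κ k L = blockSumAux u v κ k' L from H _ _ L h le_rfl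
  intro k
  induction k with
  | zero =>
    intro k' L hk hk'
    obtain rfl : L = [] := by simpa using hk
    cases k' <;> rfl
  | succ k ih =>
    intro k' L hk hk'
    cases L with
    | nil => cases k' <;> rfl
    | cons n L =>
      simp only [List.length_cons] at hk hk'
      obtain ⟨k', rfl⟩ : ∃ m, k' = m + 1 := ⟨k' - 1, by omega⟩
      simp only [blockSumAux]
      rw [ih k' L (by omega) (by omega)]
      congr 1
      · congr 1
        refine pick_congr _ _ _ fun b L' hL => ?_
        rw [ih k' L' (by omega) (by omega)]
      · refine pickTwo_congr _ _ _ fun b c L' hL => ?_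
        rw [ih k' L' (by omega) (by omega)]

theorem blockSum_nil : blockSum u v κ [] = 1 := rfl

theorem blockSum_cons (n : ℕ) (L : List ℕ) :
    blockSum u v κ (n :: L) = u n * blockSum u v κ L +
      pick L (fun b L' => v n b * blockSum u v κ L') +
      pickTwo L (fun b c L' => κ n b c * blockSum u v κ L') := by
  conv_lhs => rw [blockSum, List.length_cons, blockSumAux]
  rw [← blockSumAux_eq u v κ L.length L le_rfl]
  congr 1
  · congr 1
    refine pick_congr _ _ _ fun b L' hL => ?_
    rw [blockSumAux_eq _ _ _ _ _ (by omega)]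
  · refine pickTwo_congr _ _ _ fun b c L' hL => ?_
    rw [blockSumAux_eq _ _ _ _ _ (by omega)]

/-- The loop equations for connected correlators with one, two and three boundaries, in a ring in
which the correlators with more boundaries and most products of these vanish. -/
structure LoopEquations (y : R) : Prop where
  u_zero : u 0 = 1
  v_zero : ∀ b, v 0 b = 0
  κ_zero : ∀ b c, κ 0 b c = 0
  u_eq : ∀ n, 1 ≤ n → u n = splitSum n fun j k => v j k + u j * u k
  v_eq : ∀ n b, 1 ≤ n → v n b = (splitSum n fun j k => κ j k b + u j * v k b + v j b * u k) +
    y * (b * u (n + b - 2))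
  κ_eq : ∀ n b c, 1 ≤ n → κ n b c =
    (splitSum n fun j k => u j * κ k b c + κ j b c * u k + v j b * v k c + v j c * v k b) +
    y * (b * v (n + b - 2) c) + y * (c * v (n + c - 2) b)
  v_mul_κ : ∀ a b c d e, v a b * κ c d e = 0
  κ_mul_κ : ∀ a b c d e f, κ a b c * κ d e f = 0
  y_mul_κ : ∀ a b c, y * κ a b c = 0

variable {u v κ} {y : R}

theorem LoopEquations.blockSum_zero_cons (H : LoopEquations u v κ y) (L : List ℕ) :
    blockSum u v κ (0 :: L) = blockSum u v κ L := by
  simp [blockSum_cons, H.u_zero, H.v_zero, H.κ_zero, pick_zero, pickTwo_zero]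

/-- The two leading entries lie in one block or in two, and the terms are sorted by how many further
entries these blocks absorb. Absorbing three or more needs a product `v * κ` or `κ * κ`, which
vanishes. -/
theorem LoopEquations.blockSum_cons_cons (H : LoopEquations u v κ y) (j k : ℕ) (L : List ℕ) :
    blockSum u v κ (j :: k :: L) = (v j k + u j * u k) * blockSum u v κ L +
      pick L (fun b L' => (κ j k b + u j * v k b + v j b * u k) * blockSum u v κ L') +
      pickTwo L (fun b c L' => (u j * κ k b c + κ j b c * u k + v j b * v k c + v j c * v k b) *
        blockSum u v κ L') := by
  have h1 : pick L (fun b L' => v j b * blockSum u v κ (k :: L')) =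
      pick L (fun b L' => v j b * u k * blockSum u v κ L') +
      pickTwo L (fun b c L' => (v j b * v k c + v j c * v k b) * blockSum u v κ L') := by
    have : ∀ b L', v j b * blockSum u v κ (k :: L') = v j b * u k * blockSum u v κ L' +
        pick L' (fun c L'' => v j b * v k c * blockSum u v κ L'') := by
      intro b L'
      rw [blockSum_cons, mul_add, mul_add, mul_pick, mul_pickTwo]
      simp only [← mul_assoc, H.v_mul_κ, zero_mul, pickTwo_zero, add_zero]
    simp only [this]
    rw [pick_add L (fun b L' => v j b * u k * blockSum u v κ L')
      (fun b L' => pick L' fun c L'' => v j b * v k c * blockSum u v κ L''),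
      pick_pick L (fun b c L'' => v j b * v k c * blockSum u v κ L'')]
    simp only [add_mul]
  have h2 : pickTwo L (fun b c L' => κ j b c * blockSum u v κ (k :: L')) =
      pickTwo L (fun b c L' => κ j b c * u k * blockSum u v κ L') := by
    refine pickTwo_congr _ _ _ fun b c L' _ => ?_
    rw [blockSum_cons, mul_add, mul_add, mul_pick, mul_pickTwo]
    simp only [← mul_assoc, H.κ_mul_κ, mul_comm (κ _ _ _) (v _ _), H.v_mul_κ, zero_mul,
      pickTwo_zero, pick_zero, add_zero]
  rw [blockSum_cons]
  simp only [pick, pickTwo]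
  rw [h1, h2, blockSum_cons, mul_add, mul_add, mul_pick, mul_pickTwo]
  simp only [add_mul, pick_add, pickTwo_add, mul_assoc]
  ring

/-- Expand the block of `n` by its loop equation. The splitting terms reassemble to
`blockSum_cons_cons`; the terms with `y` are the expansion at the merged entry `n + b - 2`, whose
three-element blocks are killed by `y_mul_κ`. -/
theorem LoopEquations.blockSum_recursion (H : LoopEquations u v κ y) (n : ℕ) (hn : 1 ≤ n)
    (L : List ℕ) :
    blockSum u v κ (n :: L) = (splitSum n fun j k => blockSum u v κ (j :: k :: L)) +
      y * pick L (fun b L' => b * blockSum u v κ ((n + b - 2) :: L')) := by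
  have h1 : y * pick L (fun b L' => b * blockSum u v κ ((n + b - 2) :: L')) =
      pick L (fun b L' => y * (b * u (n + b - 2)) * blockSum u v κ L') +
      pickTwo L (fun b c L' => (y * (b * v (n + b - 2) c) + y * (c * v (n + c - 2) b)) *
        blockSum u v κ L') := by
    rw [mul_pick]
    have : ∀ (b : ℕ) L', y * (b * blockSum u v κ ((n + b - 2) :: L')) =
        y * (b * u (n + b - 2)) * blockSum u v κ L' +
        pick L' (fun c L'' => y * (b * v (n + b - 2) c) * blockSum u v κ L'') := by
      intro b L'
      rw [blockSum_cons, mul_add, mul_add, mul_add, mul_add, mul_pick, mul_pickTwo, mul_pick,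
        mul_pickTwo]
      have h0 : ∀ (b c d e : ℕ) (x : R), y * ((b : R) * (κ c d e * x)) = 0 := fun b c d e x => by
        rw [show y * ((b : R) * (κ c d e * x)) = b * x * (y * κ c d e) by ring, H.y_mul_κ, mul_zero]
      simp only [h0, pickTwo_zero, add_zero, mul_assoc]
    simp only [this]
    rw [pick_add L (fun b L' => y * (b * u (n + b - 2)) * blockSum u v κ L')
      (fun b L' => pick L' fun c L'' => y * (b * v (n + b - 2) c) * blockSum u v κ L''),
      pick_pick L (fun b c L'' => y * (b * v (n + b - 2) c) * blockSum u v κ L'')]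
    simp only [add_mul]
  rw [h1, blockSum_cons, H.u_eq n hn]
  simp only [H.v_eq n _ hn, H.κ_eq n _ _ hn, H.blockSum_cons_cons]
  simp only [splitSum, Finset.sum_add_distrib, sum_pick, sum_pickTwo, ← Finset.sum_mul]
  simp only [add_mul, pick_add, pickTwo_add]
  ring

end Expansion

/-! ### Cycles of a permutation multiplied by a transposition -/

section CycleWords

variable {X : Type*}

/-- The list `w` is nonempty and `φ` maps each entry of it to the next one, cyclically. -/
def IsCyclicWord (φ : Equiv.Perm X) (w : List X) : Prop :=
  ∃ a l, w = a :: l ∧ List.IsChain (fun x y => φ x = y) (a :: (l ++ [a]))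

/-- The lists in `ls` are the cycles of `φ`, including the fixed points, each written once. -/
structure IsCycleList (φ : Equiv.Perm X) (ls : List (List X)) : Prop where
  cyclic : ∀ w ∈ ls, IsCyclicWord φ w
  nodup : ls.flatten.Nodup
  mem : ∀ x, x ∈ ls.flatten

/-- The number of cycles of a permutation, including the fixed points. -/
noncomputable def numCycles (φ : Equiv.Perm X) : ℕ := Nat.card (Quot fun x y => φ x = y)

theorem IsCycleList.perm {φ : Equiv.Perm X} {ls ls' : List (List X)} (h : IsCycleList φ ls)
    (hp : ls.Perm ls') : IsCycleList φ ls' where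
  cyclic w hw := h.cyclic w (hp.mem_iff.2 hw)
  nodup := hp.flatten.nodup_iff.1 h.nodup
  mem x := hp.flatten.mem_iff.1 (h.mem x)

theorem isChain_mul_swap [DecidableEq X] {φ : Equiv.Perm X} {e f z : X} {A : List X} (he : e ∉ A) (hf : f ∉ A)
    (h : List.IsChain (fun x y => φ x = y) (A ++ [z])) :
    List.IsChain (fun x y => (φ * Equiv.swap e f) x = y) (A ++ [z]) := by
  induction A with
  | nil => simp
  | cons a A ih =>
    simp only [List.mem_cons, not_or] at he hf
    have ha : (φ * Equiv.swap e f) a = φ a := by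
      rw [Equiv.Perm.mul_apply, Equiv.swap_apply_of_ne_of_ne (Ne.symm he.1) (Ne.symm hf.1)]
    cases A with
    | nil =>
      simp only [List.cons_append, List.nil_append, List.isChain_cons_cons, List.isChain_singleton,
        and_true] at h ⊢
      exact ha.trans h
    | cons b A =>
      simp only [List.cons_append, List.isChain_cons_cons] at h ih ⊢
      exact ⟨ha.trans h.1, ih he.2 hf.2 h.2⟩

theorem isChain_cons_mul_swap [DecidableEq X] {φ : Equiv.Perm X} {e f z : X} {A : List X} (he : e ∉ A)
    (hf : f ∉ A) (h : List.IsChain (fun x y => φ x = y) (e :: (A ++ [z]))) :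
    List.IsChain (fun x y => (φ * Equiv.swap e f) x = y) (f :: (A ++ [z])) := by
  cases A with
  | nil => simpa using h
  | cons a A =>
    simp only [List.cons_append, List.isChain_cons_cons] at h ⊢
    exact ⟨by simpa using h.1, by simpa using isChain_mul_swap he hf h.2⟩

theorem IsCyclicWord.mul_swap [DecidableEq X] {φ : Equiv.Perm X} {e f : X} {w : List X} (he : e ∉ w) (hf : f ∉ w)
    (h : IsCyclicWord φ w) : IsCyclicWord (φ * Equiv.swap e f) w := by
  obtain ⟨a, l, rfl, hc⟩ := h
  exact ⟨a, l, rfl, by simpa using isChain_mul_swap (A := a :: l) he hf (by simpa using hc)⟩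

theorem IsCyclicWord.rotate {φ : Equiv.Perm X} {e : X} {A B : List X}
    (h : IsCyclicWord φ (A ++ e :: B)) : IsCyclicWord φ (e :: (B ++ A)) := by
  obtain ⟨a, l, hw, hc⟩ := h
  refine ⟨e, B ++ A, rfl, ?_⟩
  cases A with
  | nil =>
    simp only [List.nil_append, List.cons.injEq] at hw
    obtain ⟨rfl, rfl⟩ := hw
    simpa using hc
  | cons a' A =>
    simp only [List.cons_append, List.cons.injEq] at hw
    obtain ⟨rfl, rfl⟩ := hw
    have h1 := (List.isChain_split (l₁ := a' :: A) (c := e) (l₂ := B ++ [a'])).1 (by simpa using hc)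
    have h2 := (List.isChain_split (R := fun x y => φ x = y) (l₁ := e :: B) (c := a')
      (l₂ := A ++ [e])).2 ⟨by simpa using h1.2, by simpa using h1.1⟩
    simpa using h2

/-- The product sends `e` to `φ f` and `f` to `φ e` and agrees with `φ` elsewhere, so each of `e`,
`f` now precedes the segment that used to follow the other. -/
theorem IsCycleList.split [DecidableEq X] {φ : Equiv.Perm X} {e f : X} {A B : List X} {rs : List (List X)}
    (h : IsCycleList φ ((e :: (A ++ f :: B)) :: rs)) :
    IsCycleList (φ * Equiv.swap e f) ((f :: A) :: (e :: B) :: rs) := by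
  have hn := h.nodup
  have hp : ((e :: (A ++ f :: B)) :: rs).flatten.Perm ((f :: A) :: (e :: B) :: rs).flatten := by
    simp only [List.flatten_cons, List.cons_append, List.append_assoc]
    refine (List.Perm.cons e List.perm_middle).trans ((List.Perm.swap _ _ _).trans ?_)
    exact List.Perm.cons f List.perm_middle.symm
  refine ⟨?_, hp.nodup_iff.1 hn, fun x => hp.mem_iff.1 (h.mem x)⟩
  simp only [List.flatten_cons, List.cons_append, List.append_assoc, List.nodup_cons,
    List.nodup_append, List.mem_append, List.mem_cons, not_or] at hn
  obtain ⟨⟨heA, hef, heB, hers⟩, -, ⟨⟨hfB, hfrs⟩, -⟩, hA⟩ := hn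
  have hfA : f ∉ A := fun hf => hA f hf f (Or.inl rfl) rfl
  obtain ⟨a, l, hw, hc⟩ := h.cyclic _ List.mem_cons_self
  simp only [List.cons.injEq] at hw
  obtain ⟨rfl, rfl⟩ := hw
  have h1 := (List.isChain_split (l₁ := e :: A) (c := f) (l₂ := B ++ [e])).1 (by simpa using hc)
  intro w hw
  simp only [List.mem_cons] at hw
  rcases hw with rfl | rfl | hw
  · exact ⟨f, A, rfl, isChain_cons_mul_swap heA hfA (by simpa using h1.1)⟩
  · refine ⟨e, B, rfl, ?_⟩
    rw [Equiv.swap_comm]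
    exact isChain_cons_mul_swap hfB heB (by simpa using h1.2)
  · exact (h.cyclic w (List.mem_cons_of_mem _ hw)).mul_swap
      (fun hx => hers (List.mem_flatten_of_mem hw hx))
      (fun hx => hfrs (List.mem_flatten_of_mem hw hx))

/-- The exchange of successors that cuts a cycle containing both `e` and `f` joins two cycles that
contain one each. -/
theorem IsCycleList.merge [DecidableEq X] {φ : Equiv.Perm X} {e f : X} {A B : List X} {rs : List (List X)}
    (h : IsCycleList φ ((e :: A) :: (f :: B) :: rs)) :
    IsCycleList (φ * Equiv.swap e f) ((e :: (B ++ f :: A)) :: rs) := by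
  have hn := h.nodup
  have hp : ((e :: A) :: (f :: B) :: rs).flatten.Perm ((e :: (B ++ f :: A)) :: rs).flatten := by
    simp only [List.flatten_cons, List.cons_append, List.append_assoc]
    refine List.Perm.cons e (List.perm_middle.trans (List.Perm.trans ?_ List.perm_middle.symm))
    refine List.Perm.cons f ?_
    rw [← List.append_assoc, ← List.append_assoc]
    exact List.Perm.append_right _ List.perm_append_comm
  refine ⟨?_, hp.nodup_iff.1 hn, fun x => hp.mem_iff.1 (h.mem x)⟩
  simp only [List.flatten_cons, List.cons_append, List.nodup_cons,
    List.nodup_append, List.mem_append, List.mem_cons, not_or] at hn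
  obtain ⟨⟨heA, hef, heB, hers⟩, -, ⟨⟨hfB, hfrs⟩, -⟩, hA⟩ := hn
  have hfA : f ∉ A := fun hf => hA f hf f (Or.inl rfl) rfl
  obtain ⟨a, l, hw, hc⟩ := h.cyclic _ List.mem_cons_self
  simp only [List.cons.injEq] at hw
  obtain ⟨rfl, rfl⟩ := hw
  obtain ⟨a, l, hw, hc'⟩ := h.cyclic _ (List.mem_cons_of_mem _ List.mem_cons_self)
  simp only [List.cons.injEq] at hw
  obtain ⟨rfl, rfl⟩ := hw
  intro w hw
  simp only [List.mem_cons] at hw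
  rcases hw with rfl | hw
  · refine ⟨e, B ++ f :: A, rfl, ?_⟩
    have h1 : List.IsChain (fun x y => (φ * Equiv.swap e f) x = y) (e :: (B ++ [f])) := by
      rw [Equiv.swap_comm]
      exact isChain_cons_mul_swap hfB heB hc'
    have h2 := (List.isChain_split (R := fun x y => (φ * Equiv.swap e f) x = y) (l₁ := e :: B)
      (c := f) (l₂ := A ++ [e])).2 ⟨h1, isChain_cons_mul_swap heA hfA hc⟩
    simpa using h2
  · exact (h.cyclic w (List.mem_cons_of_mem _ (List.mem_cons_of_mem _ hw))).mul_swap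
      (fun hx => hers (List.mem_flatten_of_mem hw hx))
      (fun hx => hfrs (List.mem_flatten_of_mem hw hx))

theorem IsCycleList.rotate {φ : Equiv.Perm X} {e : X} {w : List X} {rs : List (List X)}
    (h : IsCycleList φ (w :: rs)) (he : e ∈ w) :
    ∃ A, w.Perm (e :: A) ∧ IsCycleList φ ((e :: A) :: rs) := by
  obtain ⟨A, B, rfl⟩ := List.append_of_mem he
  have hp : (A ++ e :: B).Perm (e :: (B ++ A)) := List.perm_append_comm
  refine ⟨B ++ A, hp, ?_, ?_, ?_⟩
  · intro w hw
    simp only [List.mem_cons] at hw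
    rcases hw with rfl | hw
    · exact (h.cyclic _ List.mem_cons_self).rotate
    · exact h.cyclic w (List.mem_cons_of_mem _ hw)
  · exact (hp.append_right rs.flatten).nodup_iff.1 h.nodup
  · exact fun x => (hp.append_right rs.flatten).mem_iff.1 (h.mem x)

theorem isChain_quot_eq {φ : Equiv.Perm X} {a : X} {l : List X}
    (h : List.IsChain (fun x y => φ x = y) (a :: l)) :
    ∀ x ∈ a :: l, Quot.mk (fun x y => φ x = y) x = Quot.mk _ a := by
  induction l generalizing a with
  | nil => simp
  | cons b l ih =>
    rw [List.isChain_cons_cons] at h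
    intro x hx
    rw [List.mem_cons] at hx
    rcases hx with rfl | hx
    · rfl
    · exact (ih h.2 x hx).trans (Quot.sound (r := fun x y => φ x = y) h.1).symm

theorem isChain_apply_mem {φ : Equiv.Perm X} {z : X} {l : List X}
    (h : List.IsChain (fun x y => φ x = y) (l ++ [z])) : ∀ x ∈ l, φ x ∈ l ++ [z] := by
  induction l with
  | nil => simp
  | cons a l ih =>
    intro x hx
    rw [List.mem_cons] at hx
    cases l with
    | nil =>
      simp only [List.not_mem_nil, or_false] at hx
      subst hx
      simp only [List.cons_append, List.nil_append, List.isChain_cons_cons] at h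
      simp [h.1]
    | cons b l =>
      rw [List.cons_append, List.cons_append, List.isChain_cons_cons] at h
      rcases hx with rfl | hx
      · simp [h.1]
      · exact List.mem_cons_of_mem _ (ih h.2 x hx)

theorem IsCyclicWord.apply_mem {φ : Equiv.Perm X} {w : List X} (h : IsCyclicWord φ w) {x : X}
    (hx : x ∈ w) : φ x ∈ w := by
  obtain ⟨a, l, rfl, hc⟩ := h
  have := isChain_apply_mem (l := a :: l) (by simpa using hc) x hx
  simp only [List.cons_append, List.mem_cons, List.mem_append, List.not_mem_nil, or_false] at this
  rw [List.mem_cons]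
  tauto

theorem IsCycleList.eq_of_mem {φ : Equiv.Perm X} {ls : List (List X)} (h : IsCycleList φ ls)
    {w w' : List X} (hw : w ∈ ls) (hw' : w' ∈ ls) {x : X} (hx : x ∈ w) (hx' : x ∈ w') :
    w = w' := by
  by_contra hne
  have : Std.Symm (List.Disjoint : List X → List X → Prop) := ⟨fun _ _ h => h.symm⟩
  exact (List.nodup_flatten.1 h.nodup).2.forall hw hw' hne hx hx'

theorem IsCycleList.numCycles_eq {φ : Equiv.Perm X} {ls : List (List X)} (h : IsCycleList φ ls) :
    numCycles φ = ls.length := by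
  classical
  have hd := (List.nodup_flatten.1 h.nodup).2
  have hne : ∀ w ∈ ls, w ≠ [] := by
    intro w hw
    obtain ⟨a, l, rfl, -⟩ := h.cyclic w hw
    simp
  let f : {w // w ∈ ls} → Quot fun x y => φ x = y := fun w => Quot.mk _ (w.1.head (hne _ w.2))
  have hf : Function.Bijective f := by
    constructor
    · rintro ⟨w, hw⟩ ⟨w', hw'⟩ heq
      -- Membership in a listed cycle is invariant under `φ`, so it descends to the quotient and
      -- tells the classes of the heads apart.
      have hinv : ∀ x y, φ x = y → (x ∈ w) = (y ∈ w) := by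
        rintro x _ rfl
        refine propext ⟨fun hx => (h.cyclic w hw).apply_mem hx, fun hx => ?_⟩
        obtain ⟨w'', hw'', hx''⟩ := List.mem_flatten.1 (h.mem x)
        rwa [h.eq_of_mem hw hw'' hx ((h.cyclic w'' hw'').apply_mem hx'')]
      have h1 : Quot.lift (fun x => x ∈ w) hinv (f ⟨w, hw⟩) := List.head_mem (hne w hw)
      rw [heq] at h1
      exact Subtype.ext (h.eq_of_mem hw hw' h1 (List.head_mem (hne w' hw')))
    · intro q
      obtain ⟨x, rfl⟩ := Quot.exists_rep q
      obtain ⟨w, hw, hx⟩ := List.mem_flatten.1 (h.mem x)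
      refine ⟨⟨w, hw⟩, ?_⟩
      obtain ⟨a, l, rfl, hc⟩ := h.cyclic w hw
      exact (isChain_quot_eq hc x (by rw [← List.cons_append]; exact List.mem_append_left _ hx)).symm
  have hls : ls.Nodup := hd.imp_of_mem fun {a b} ha _ hab hab' => by
    subst hab'
    exact hne a ha (List.eq_nil_iff_forall_not_mem.2 fun x hx => hab hx hx)
  rw [numCycles, ← Nat.card_eq_of_bijective f hf]
  rw [← List.toFinset_card_of_nodup hls, ← Fintype.card_coe, ← Nat.card_eq_fintype_card]
  exact Nat.card_congr (Equiv.subtypeEquivRight fun w => by simp)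

end CycleWords

/-! ### Matchings as involutions, and removal of one pair -/

section Matchings

variable {X : Type*} [DecidableEq X] [Fintype X]

/-- The involutions that move exactly the points of `S`. -/
def matchings (S : Finset X) : Finset (Equiv.Perm X) :=
  {α | (∀ x, α (α x) = x) ∧ ∀ x, α x ≠ x ↔ x ∈ S}

theorem mem_matchings {S : Finset X} {α : Equiv.Perm X} :
    α ∈ matchings S ↔ (∀ x, α (α x) = x) ∧ ∀ x, α x ≠ x ↔ x ∈ S := by
  simp [matchings]

theorem matchings_empty : matchings (∅ : Finset X) = {1} := by
  ext α
  simp only [mem_matchings, Finset.notMem_empty, iff_false, not_not, Finset.mem_singleton]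
  constructor
  · exact fun h => Equiv.ext h.2
  · rintro rfl; simp

theorem apply_mem_erase_of_mem_matchings {S : Finset X} {α : Equiv.Perm X} (h : α ∈ matchings S)
    {e : X} (he : e ∈ S) : α e ∈ S.erase e := by
  rw [mem_matchings] at h
  refine Finset.mem_erase.2 ⟨(h.2 e).2 he, (h.2 _).1 ?_⟩
  rw [h.1]
  exact ((h.2 e).2 he).symm

theorem swap_mul_mem_matchings {S : Finset X} {α : Equiv.Perm X} (h : α ∈ matchings S)
    {e f : X} (hf : α e = f) :
    Equiv.swap e f * α ∈ matchings ((S.erase e).erase f) := by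
  rw [mem_matchings] at h ⊢
  have hf' : α f = e := by rw [← hf, h.1]
  have key : ∀ x, x ≠ e → x ≠ f → (Equiv.swap e f * α) x = α x := by
    intro x hxe hxf
    rw [Equiv.Perm.mul_apply, Equiv.swap_apply_of_ne_of_ne]
    · exact fun h => hxf (α.injective (h.trans hf'.symm))
    · exact fun h => hxe (α.injective (h.trans hf.symm))
  have ke : (Equiv.swap e f * α) e = e := by simp [hf]
  have kf : (Equiv.swap e f * α) f = f := by simp [hf']
  constructor
  · intro x
    by_cases hxe : x = e
    · subst hxe; rw [ke, ke]
    by_cases hxf : x = f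
    · subst hxf; rw [kf, kf]
    rw [key x hxe hxf, key, h.1]
    · exact fun h => hxf (α.injective (h.trans hf'.symm))
    · exact fun h => hxe (α.injective (h.trans hf.symm))
  · intro x
    by_cases hxe : x = e
    · subst hxe; simp [ke]
    by_cases hxf : x = f
    · subst hxf; simp [kf]
    rw [key x hxe hxf, h.2]
    simp [hxe, hxf]

theorem swap_mul_mem_matchings' {S : Finset X} {α : Equiv.Perm X} {e f : X} (he : e ∈ S)
    (hf : f ∈ S.erase e) (h : α ∈ matchings ((S.erase e).erase f)) :
    Equiv.swap e f * α ∈ matchings S ∧ (Equiv.swap e f * α) e = f := by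
  rw [mem_matchings] at h ⊢
  obtain ⟨hfe, hfS⟩ := Finset.mem_erase.1 hf
  have ke : α e = e := by
    by_contra hc
    have := (h.2 e).1 hc
    simp at this
  have kf : α f = f := by
    by_contra hc
    have := (h.2 f).1 hc
    simp at this
  have key : ∀ x, x ≠ e → x ≠ f → (Equiv.swap e f * α) x = α x := by
    intro x hxe hxf
    rw [Equiv.Perm.mul_apply, Equiv.swap_apply_of_ne_of_ne]
    · exact fun h => hxe (α.injective (h.trans ke.symm))
    · exact fun h => hxf (α.injective (h.trans kf.symm))
  have ke' : (Equiv.swap e f * α) e = f := by simp [ke]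
  have kf' : (Equiv.swap e f * α) f = e := by simp [kf]
  refine ⟨⟨?_, ?_⟩, ke'⟩
  · intro x
    by_cases hxe : x = e
    · subst hxe; rw [ke', kf']
    by_cases hxf : x = f
    · subst hxf; rw [kf', ke']
    rw [key x hxe hxf, key, h.1]
    · exact fun h => hxe (α.injective (h.trans ke.symm))
    · exact fun h => hxf (α.injective (h.trans kf.symm))
  · intro x
    by_cases hxe : x = e
    · subst hxe; simp [ke', he, hfe]
    by_cases hxf : x = f
    · subst hxf; simp [kf', hfS, Ne.symm hfe]
    rw [key x hxe hxf, h.2]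
    simp [hxe, hxf]

/-- Sort the matchings by the partner `f` of `e`. Left multiplication by `swap e f` removes the pair
from `α`, and the transposition is absorbed into `φ`. -/
theorem sum_matchings {M : Type*} [AddCommMonoid M] {S : Finset X} {e : X} (he : e ∈ S)
    (φ : Equiv.Perm X) (g : Equiv.Perm X → M) :
    ∑ α ∈ matchings S, g (φ * α) =
      ∑ f ∈ S.erase e, ∑ α ∈ matchings ((S.erase e).erase f), g (φ * Equiv.swap e f * α) := by
  rw [← Finset.sum_fiberwise_of_maps_to (t := S.erase e) (g := fun α : Equiv.Perm X => α e)
    fun α hα => apply_mem_erase_of_mem_matchings hα he]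
  refine Finset.sum_congr rfl fun f hf => ?_
  refine Finset.sum_bij' (fun α _ => Equiv.swap e f * α) (fun α _ => Equiv.swap e f * α) ?_ ?_ ?_ ?_
    ?_
  · intro α hα
    rw [Finset.mem_filter] at hα
    exact swap_mul_mem_matchings hα.1 hα.2
  · intro α hα
    rw [Finset.mem_filter]
    exact swap_mul_mem_matchings' he hf hα
  · intro α _; simp [← mul_assoc]
  · intro α _; simp [← mul_assoc]
  · intro α _
    congr 1
    rw [mul_assoc, ← mul_assoc (Equiv.swap e f) (Equiv.swap e f), Equiv.swap_mul_self, one_mul]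

end Matchings

/-! ### The split-and-merge recursion for all matchings -/

section Enumeration

variable {X : Type*} [DecidableEq X]

/-- The number of entries of the list `w` that lie in `S`. -/
def countIn (S : Finset X) (w : List X) : ℕ := w.countP (· ∈ S)

theorem countIn_cons_of_mem {S : Finset X} {a : X} (h : a ∈ S) (w : List X) :
    countIn S (a :: w) = countIn S w + 1 := by simp [countIn, h]

theorem countIn_cons_of_notMem {S : Finset X} {a : X} (h : a ∉ S) (w : List X) :
    countIn S (a :: w) = countIn S w := by simp [countIn, h]

theorem countIn_append (S : Finset X) (w w' : List X) :
    countIn S (w ++ w') = countIn S w + countIn S w' := by simp [countIn]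

theorem countIn_erase {S : Finset X} {e f : X} {w : List X} (he : e ∉ w) (hf : f ∉ w) :
    countIn ((S.erase e).erase f) w = countIn S w := by
  refine List.countP_congr fun x hx => ?_
  have h1 : x ≠ e := fun h => he (h ▸ hx)
  have h2 : x ≠ f := fun h => hf (h ▸ hx)
  simp [h1, h2]

/-- For a partner in the same cycle only the numbers of marked entries before and after it matter,
and these run over all pairs with sum `countIn S A - 1`. -/
theorem sum_filter_eq_sum_range {R : Type*} [AddCommMonoid R] (S : Finset X) (A : List X) (g : X → R)
    (F : ℕ → ℕ → R)
    (h : ∀ A₁ f B₁, A = A₁ ++ f :: B₁ → f ∈ S → g f = F (countIn S A₁) (countIn S B₁)) :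
    ((A.filter (· ∈ S)).map g).sum =
      ∑ j ∈ Finset.range (countIn S A), F j (countIn S A - 1 - j) := by
  induction A generalizing F with
  | nil => simp [countIn]
  | cons a A ih =>
    by_cases ha : a ∈ S
    · rw [countIn_cons_of_mem ha, Finset.sum_range_succ', List.filter_cons_of_pos (by simpa using ha),
        List.map_cons, List.sum_cons, ih fun i j => F (i + 1) j]
      · rw [h [] a A rfl ha, add_comm]
        congr 1
        exact Finset.sum_congr rfl fun j hj => by
          congr 1
          omega
      · intro A₁ f B₁ hA hf
        rw [h (a :: A₁) f B₁ (by simp [hA]) hf, countIn_cons_of_mem ha]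
    · rw [countIn_cons_of_notMem ha, List.filter_cons_of_neg (by simpa using ha), ih F]
      intro A₁ f B₁ hA hf
      rw [h (a :: A₁) f B₁ (by simp [hA]) hf, countIn_cons_of_notMem ha]

/-- All `b` marked entries of one word contribute the same term; this is the source of the factor
`b` in the loop equations. -/
theorem sum_filter_flatten_eq_pick {R : Type*} [CommRing R] (S : Finset X) (ls : List (List X))
    (g : X → R) (F : ℕ → List ℕ → R)
    (h : ∀ L₁ w L₂, ls = L₁ ++ w :: L₂ → ∀ f ∈ w, f ∈ S →
      g f = F (countIn S w) ((L₁ ++ L₂).map (countIn S))) :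
    ((ls.flatten.filter (· ∈ S)).map g).sum =
      pick (ls.map (countIn S)) fun b L' => b * F b L' := by
  induction ls generalizing F with
  | nil => simp [pick]
  | cons w ls ih =>
    rw [List.flatten_cons, List.filter_append, List.map_append, List.sum_append, List.map_cons, pick,
      ih fun b L' => F b (countIn S w :: L')]
    · congr 1
      have : ∀ x ∈ (w.filter (· ∈ S)).map g, x = F (countIn S w) (ls.map (countIn S)) := by
        intro x hx
        obtain ⟨f, hf, rfl⟩ := List.mem_map.1 hx
        rw [List.mem_filter] at hf
        exact h [] w ls rfl f hf.1 (by simpa using hf.2)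
      rw [List.eq_replicate_of_mem this, List.sum_replicate, List.length_map, nsmul_eq_mul,
        ← List.countP_eq_length_filter]
      rfl
    · intro L₁ w' L₂ hls f hf hfS
      rw [h (w :: L₁) w' L₂ (by simp [hls]) f hf hfS]
      simp

variable [Fintype X] {R : Type*} [CommRing R]

/-- For all matchings `α` of `S` the number `c - 2 * numCycles (φ * α)` is a multiple `4 * h` of
four, and the powers `y ^ h` add up to `r`. -/
def GenusSum (y : R) (c : ℕ) (S : Finset X) (φ : Equiv.Perm X) (r : R) : Prop :=
  (∀ α ∈ matchings S, ∃ h, c = 2 * numCycles (φ * α) + 4 * h) ∧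
    ∑ α ∈ matchings S, y ^ ((c - 2 * numCycles (φ * α)) / 4) = r

/-- A merge uses up two marked points and one cycle, lowering `S.card` plus twice the number of
cycles by four. A split leaves this quantity unchanged, so only merges produce a factor `y`. -/
theorem GenusSum.add_four {y : R} {c : ℕ} {S : Finset X} {φ : Equiv.Perm X} {r : R}
    (h : GenusSum y c S φ r) : GenusSum y (c + 4) S φ (y * r) := by
  constructor
  · intro α hα
    obtain ⟨k, hk⟩ := h.1 α hα
    exact ⟨k + 1, by omega⟩
  · rw [← h.2, Finset.mul_sum]
    refine Finset.sum_congr rfl fun α hα => ?_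
    obtain ⟨k, hk⟩ := h.1 α hα
    rw [← pow_succ']
    congr 1
    omega

theorem GenusSum.of_erase {y : R} {c : ℕ} {S : Finset X} {φ : Equiv.Perm X} {e : X} (he : e ∈ S)
    (t : X → R) (h : ∀ f ∈ S.erase e,
      GenusSum y c ((S.erase e).erase f) (φ * Equiv.swap e f) (t f)) :
    GenusSum y c S φ (∑ f ∈ S.erase e, t f) := by
  constructor
  · intro α hα
    obtain ⟨k, hk⟩ := (h _ (apply_mem_erase_of_mem_matchings hα he)).1 _
      (swap_mul_mem_matchings hα rfl)
    refine ⟨k, ?_⟩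
    rwa [mul_assoc, ← mul_assoc (Equiv.swap e (α e)), Equiv.swap_mul_self, one_mul] at hk
  · rw [sum_matchings he φ fun σ => y ^ ((c - 2 * numCycles σ) / 4)]
    exact Finset.sum_congr rfl fun f hf => (h f hf).2

theorem genusSum_empty (y : R) {φ : Equiv.Perm X} {ls : List (List X)} (h : IsCycleList φ ls) :
    GenusSum y (2 * ls.length) ∅ φ 1 := by
  simp [GenusSum, matchings_empty, h.numCycles_eq]

/-- Induction on the number of marked points. The words in `zs` are cycles without marked points:
they can no longer take part in a split or merge and enter only through their number. -/
theorem GenusSum.blockSum {u : ℕ → R} {v : ℕ → ℕ → R} {κ : ℕ → ℕ → ℕ → R} {y : R}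
    (H : LoopEquations u v κ y) (S : Finset X) (φ : Equiv.Perm X) (zs ls : List (List X))
    (hφ : IsCycleList φ (zs ++ ls)) (hzs : ∀ w ∈ zs, ∀ x ∈ w, x ∉ S) :
    GenusSum y (S.card + 2 * (zs ++ ls).length) S φ (blockSum u v κ (ls.map (countIn S))) := by
  induction hm : S.card using Nat.strong_induction_on generalizing S φ zs ls with
  | _ m IH =>
  subst hm
  induction ls generalizing zs with
  | nil =>
    have hS : S = ∅ := by
      refine Finset.eq_empty_of_forall_notMem fun x hx => ?_
      obtain ⟨w, hw, hxw⟩ := List.mem_flatten.1 (hφ.mem x)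
      exact hzs w (by simpa using hw) x hxw hx
    subst hS
    simpa [blockSum_nil] using genusSum_empty y hφ
  | cons w ls ih =>
    -- An exhausted word joins `zs`; this changes neither `S` nor the number of cycles, so the inner
    -- induction over `ls` applies.
    by_cases hw : ∀ x ∈ w, x ∉ S
    · have := ih (w :: zs) (hφ.perm List.perm_middle) (by simpa using ⟨hw, hzs⟩)
      have h0 : countIn S w = 0 := by simpa [countIn, List.countP_eq_zero] using hw
      rw [List.map_cons, h0, H.blockSum_zero_cons]
      simpa [add_assoc, add_comm, add_left_comm] using this
    push Not at hw
    obtain ⟨e, hew, he⟩ := hw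
    obtain ⟨A, hwA, hA⟩ := (hφ.perm List.perm_middle).rotate hew
    set c := S.card + 2 * (zs ++ w :: ls).length with hc
    -- The contribution of partner `f`, kept as an unevaluated sum because its value depends on
    -- whether `f` lies in the cycle of `e` (`hsplit`) or in another one (`hmerge`).
    set t : X → R := fun f => ∑ α ∈ matchings ((S.erase e).erase f),
      y ^ ((c - 2 * numCycles (φ * Equiv.swap e f * α)) / 4) with ht
    have hcard : ∀ f ∈ S.erase e, ((S.erase e).erase f).card + 2 = S.card := by
      intro f hf
      have h1 := Finset.card_erase_add_one hf
      have h2 := Finset.card_erase_add_one he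
      omega
    have hzs' : ∀ f, ∀ w ∈ zs, ∀ x ∈ w, x ∉ (S.erase e).erase f := fun f w hw x hx hxS =>
      hzs w hw x hx (Finset.mem_of_mem_erase (Finset.mem_of_mem_erase hxS))
    have hnd := hA.nodup
    simp only [List.flatten_cons, List.cons_append, List.flatten_append, List.nodup_cons,
      List.nodup_append, List.mem_append, not_or] at hnd
    obtain ⟨⟨heA, hezs, hels⟩, hAn, ⟨-, hlsn, -⟩, hAd⟩ := hnd
    have hsplit : ∀ A₁ f B₁, A = A₁ ++ f :: B₁ → f ∈ S →
        GenusSum y c ((S.erase e).erase f) (φ * Equiv.swap e f)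
          (_root_.blockSum u v κ (countIn S A₁ :: countIn S B₁ :: ls.map (countIn S))) := by
      rintro A₁ f B₁ rfl hf
      have hfA : f ∈ A₁ ++ f :: B₁ := by simp
      have hfe : f ∈ S.erase e := Finset.mem_erase.2 ⟨fun h => heA (h ▸ hfA), hf⟩
      have hC : IsCycleList (φ * Equiv.swap e f) (zs ++ (f :: A₁) :: (e :: B₁) :: ls) := by
        refine hA.split.perm ?_
        exact ((List.perm_middle (l₁ := zs)).trans (List.Perm.cons _ List.perm_middle)).symm
      have hfA₁ : f ∉ A₁ ∧ f ∉ B₁ := by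
        rw [List.nodup_append] at hAn
        exact ⟨fun h => hAn.2.2 f h f (by simp) rfl, (List.nodup_cons.1 hAn.2.1).1⟩
      simp only [List.mem_append, List.mem_cons, not_or] at heA
      have := IH _ (by have := hcard f hfe; omega) _ _ _ _ hC (hzs' f) rfl
      rw [List.map_cons, List.map_cons, countIn_cons_of_notMem (by simp),
        countIn_cons_of_notMem (by simp), countIn_erase heA.1 hfA₁.1,
        countIn_erase heA.2.2 hfA₁.2] at this
      convert this using 1
      · rw [hc, ← hcard f hfe]
        simp only [List.length_append, List.length_cons]
        ring
      · congr 3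
        refine List.map_congr_left fun w' hw' => (countIn_erase ?_ ?_).symm
        · exact fun h => hels (List.mem_flatten_of_mem hw' h)
        · exact fun h => hAd f hfA f (Or.inr (List.mem_flatten_of_mem hw' h)) rfl
    have hmerge : ∀ L₁ w' L₂, ls = L₁ ++ w' :: L₂ → ∀ f ∈ w', f ∈ S →
        GenusSum y c ((S.erase e).erase f) (φ * Equiv.swap e f)
          (y * _root_.blockSum u v κ ((countIn S A + 1 + countIn S w' - 2) ::
            (L₁ ++ L₂).map (countIn S))) := by
      rintro L₁ w' L₂ rfl f hfw hf
      have hfls : f ∈ (L₁ ++ w' :: L₂).flatten := List.mem_flatten_of_mem (by simp) hfw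
      have hfe : f ∈ S.erase e := Finset.mem_erase.2 ⟨fun h => hels (h ▸ hfls), hf⟩
      have hfA : f ∉ A := fun h => hAd f h f (Or.inr hfls) rfl
      have hp : ((e :: A) :: (zs ++ (L₁ ++ w' :: L₂))).Perm
          (w' :: (e :: A) :: (zs ++ (L₁ ++ L₂))) := by
        refine (List.Perm.cons _ ?_).trans (List.Perm.swap _ _ _)
        rw [← List.append_assoc, ← List.append_assoc]
        exact List.perm_middle
      obtain ⟨B, hwB, hB⟩ := (hA.perm hp).rotate hfw
      have hC : IsCycleList (φ * Equiv.swap e f) (zs ++ (e :: (B ++ f :: A)) :: (L₁ ++ L₂)) :=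
        (hB.perm (List.Perm.swap _ _ _)).merge.perm List.perm_middle.symm
      have hnd := hB.nodup
      simp only [List.flatten_cons, List.cons_append, List.nodup_cons, List.mem_append,
        List.mem_cons, not_or, List.flatten_append] at hnd
      obtain ⟨⟨hfB, -, -, -, hfL₁, hfL₂⟩, -⟩ := hnd
      simp only [List.flatten_append, List.flatten_cons, List.mem_append, not_or] at hels
      have heB : e ∉ B := fun h => hels.2.1 (hwB.mem_iff.2 (by simp [h]))
      have := (IH _ (by have := hcard f hfe; omega) _ _ _ _ hC (hzs' f) rfl).add_four
      rw [List.map_cons, countIn_cons_of_notMem (by simp), countIn_append,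
        countIn_cons_of_notMem (by simp), countIn_erase heB hfB,
        countIn_erase heA hfA] at this
      have hcw : countIn S w' = countIn S B + 1 := by
        rw [← countIn_cons_of_mem hf]
        exact hwB.countP_eq _
      convert this using 1
      · rw [hc, ← hcard f hfe]
        simp only [List.length_append, List.length_cons]
        ring
      · congr 3
        · omega
        · refine List.map_congr_left fun w'' hw'' => (countIn_erase ?_ ?_).symm
          · rw [List.mem_append] at hw''
            rcases hw'' with hw'' | hw''
            · exact fun h => hels.1 (List.mem_flatten_of_mem hw'' h)
            · exact fun h => hels.2.2 (List.mem_flatten_of_mem hw'' h)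
          · rw [List.mem_append] at hw''
            rcases hw'' with hw'' | hw''
            · exact fun h => hfL₁ (List.mem_flatten_of_mem hw'' h)
            · exact fun h => hfL₂ (List.mem_flatten_of_mem hw'' h)
    have hset : S.erase e = ((A ++ ls.flatten).filter (· ∈ S)).toFinset := by
      ext x
      simp only [Finset.mem_erase, List.toFinset_filter, decide_eq_true_eq, Finset.mem_filter,
        List.mem_toFinset, List.mem_append]
      constructor
      · rintro ⟨hxe, hxS⟩
        refine ⟨?_, hxS⟩
        have := hA.mem x
        simp only [List.flatten_cons, List.cons_append, List.flatten_append, List.mem_cons,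
          List.mem_append, hxe, false_or] at this
        rcases this with h | h | h
        · exact Or.inl h
        · obtain ⟨w', hw', hx⟩ := List.mem_flatten.1 h
          exact absurd hxS (hzs w' hw' x hx)
        · exact Or.inr h
      · rintro ⟨h | h, hxS⟩
        · exact ⟨fun hx => heA (hx ▸ h), hxS⟩
        · exact ⟨fun hx => hels (hx ▸ h), hxS⟩
    have hnodup : ((A ++ ls.flatten).filter (· ∈ S)).Nodup :=
      (List.nodup_append.2 ⟨hAn, hlsn, fun a ha b hb => hAd a ha b (Or.inr hb)⟩).filter _
    have hstep : GenusSum y c S φ (∑ f ∈ S.erase e, t f) := by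
      refine GenusSum.of_erase he t fun f hf => ⟨?_, rfl⟩
      rw [hset, List.mem_toFinset, List.mem_filter, List.mem_append] at hf
      obtain ⟨hf | hf, hfS⟩ := hf
      · obtain ⟨A₁, B₁, hAB⟩ := List.append_of_mem hf
        exact (hsplit A₁ f B₁ hAB (by simpa using hfS)).1
      · obtain ⟨w', hw', hfw⟩ := List.mem_flatten.1 hf
        obtain ⟨L₁, L₂, hL⟩ := List.append_of_mem hw'
        exact (hmerge L₁ w' L₂ hL f hfw (by simpa using hfS)).1
    convert hstep using 1
    have hcw : countIn S w = countIn S A + 1 := by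
      rw [← countIn_cons_of_mem he]
      exact hwA.countP_eq _
    rw [hset, List.sum_toFinset _ hnodup, List.filter_append, List.map_append, List.sum_append,
      sum_filter_eq_sum_range S A t
        (fun j k => _root_.blockSum u v κ (j :: k :: ls.map (countIn S)))
        fun A₁ f B₁ h hf => (hsplit A₁ f B₁ h hf).2,
      sum_filter_flatten_eq_pick S ls t
        (fun b L' => y * _root_.blockSum u v κ ((countIn S A + 1 + b - 2) :: L'))
        fun L₁ w' L₂ h f hf hfS => (hmerge L₁ w' L₂ h f hf hfS).2,
      List.map_cons, hcw, H.blockSum_recursion _ (by omega), mul_pick]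
    congr 1
    congr 1
    ext b L'
    ring

end Enumeration

/-! ### Power series solving the loop equations -/

namespace Correlator

open PowerSeries

/-- The generating series of the planar gluings of one polygon, by the number of sides. -/
noncomputable def planarDisk : ℚ⟦X⟧ :=
  expand 2 two_ne_zero (PowerSeries.map (Nat.castRingHom ℚ) catalanSeries)

theorem planarDisk_eq : planarDisk = 1 + X ^ 2 * planarDisk ^ 2 := by
  have h := congrArg (fun f => expand 2 two_ne_zero (PowerSeries.map (Nat.castRingHom ℚ) f))
    catalanSeries_sq_mul_X_add_one
  simp only [map_add, map_mul, map_pow, map_one, map_X, expand_X] at h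
  rw [planarDisk]
  linear_combination -h

theorem constantCoeff_planarDisk : constantCoeff planarDisk = 1 := by
  rw [planarDisk_eq]
  simp

/-- The square root of `1 - 4 * X ^ 2`. -/
noncomputable def root : ℚ⟦X⟧ := 1 - 2 * X ^ 2 * planarDisk

/-- The inverse of the square root of `1 - 4 * X ^ 2`. -/
noncomputable def invRoot : ℚ⟦X⟧ := root⁻¹

theorem root_mul_invRoot : root * invRoot = 1 :=
  PowerSeries.mul_inv_cancel _ (by simp [root])

theorem root_sq : root ^ 2 = 1 - 4 * X ^ 2 := by
  rw [root]
  linear_combination (-4 * X ^ 2) * planarDisk_eq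

theorem invRoot_sq_mul : invRoot ^ 2 * (1 - 4 * X ^ 2) = 1 := by
  rw [← root_sq, ← mul_pow, mul_comm, root_mul_invRoot, one_pow]

theorem derivative_root : d⁄dX ℚ root = -4 * X * invRoot := by
  have h := congrArg (d⁄dX ℚ) root_sq
  have h4 : d⁄dX ℚ (4 : ℚ⟦X⟧) = 0 := by
    rw [show (4 : ℚ⟦X⟧) = C (4 : ℚ) from (map_ofNat C 4).symm, derivative_C]
  simp only [sq, Derivation.leibniz, map_sub, smul_eq_mul, Derivation.map_one_eq_zero,
    derivative_X, h4] at h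
  have h2 : (2 : ℚ⟦X⟧) * (root * d⁄dX ℚ root + 4 * X) = 0 := by linear_combination h
  have h3 : root * d⁄dX ℚ root + 4 * X = 0 := by
    rcases mul_eq_zero.1 h2 with h | h
    · exact absurd (congrArg (constantCoeff (R := ℚ)) h) (by rw [map_ofNat, map_zero]; norm_num)
    · exact h
  linear_combination invRoot * h3 - (d⁄dX ℚ root) * root_mul_invRoot

theorem derivative_invRoot : d⁄dX ℚ invRoot = 4 * X * invRoot ^ 3 := by
  rw [invRoot, derivative_inv', ← invRoot, derivative_root]
  ring

theorem derivative_invRoot_pow (n : ℕ) :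
    d⁄dX ℚ (invRoot ^ n) = (n : ℚ⟦X⟧) * 4 * X * invRoot ^ (n + 2) := by
  rw [derivative_pow, derivative_invRoot]
  cases n with
  | zero => simp
  | succ n =>
    rw [Nat.add_sub_cancel]
    push_cast
    ring

/-- The solution of a linear loop equation with the given inhomogeneous part. -/
theorem invRoot_mul_eq (F : ℚ⟦X⟧) :
    invRoot * F = X ^ 2 * (planarDisk * (invRoot * F)) + X ^ 2 * (invRoot * F * planarDisk) + F := by
  have h := root_mul_invRoot
  rw [root] at h
  linear_combination F * h

/-- The contribution to the loop equation of gluing a side of the first polygon to one of the `b`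
sides of another polygon. -/
noncomputable def mergeSeries (W : ℚ⟦X⟧) (b : ℕ) : ℚ⟦X⟧ :=
  mk fun n => if n = 0 then 0 else b * coeff (n + b - 2) W

/-- The series in `X` with coefficients the sums over the diagonals: `∑ b, X ^ b * F b`. -/
noncomputable def diagSeries (F : ℕ → ℚ⟦X⟧) : ℚ⟦X⟧ :=
  mk fun n => ∑ p ∈ Finset.HasAntidiagonal.antidiagonal n, coeff p.1 (F p.2)

/-- Two polygons glued into a sphere, by the number of sides of the first one. -/
noncomputable def planarTwo (b : ℕ) : ℚ⟦X⟧ := invRoot * mergeSeries planarDisk b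

/-- One polygon glued into a torus. -/
noncomputable def torusOne : ℚ⟦X⟧ := invRoot * (X ^ 2 * diagSeries planarTwo)

/-- Three polygons glued into a sphere, by the number of sides of the first one. -/
noncomputable def planarThree (b c : ℕ) : ℚ⟦X⟧ :=
  invRoot * (2 * X ^ 2 * planarTwo b * planarTwo c + mergeSeries (planarTwo c) b +
    mergeSeries (planarTwo b) c)

/-- Two polygons glued into a torus, by the number of sides of the first one. -/
noncomputable def torusTwo (b : ℕ) : ℚ⟦X⟧ :=
  invRoot * (X ^ 2 * diagSeries (fun k => planarThree k b) + 2 * X ^ 2 * torusOne * planarTwo b +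
    mergeSeries torusOne b)

/-- One polygon glued into a surface of genus two. -/
noncomputable def genusTwoOne : ℚ⟦X⟧ :=
  invRoot * (X ^ 2 * diagSeries torusTwo + X ^ 2 * torusOne ^ 2)

theorem splitSum_eq_coeff {n : ℕ} (g : ℕ → ℕ → ℚ) :
    splitSum n g = coeff n (X ^ 2 * mk fun m => ∑ p ∈ Finset.HasAntidiagonal.antidiagonal m, g p.1 p.2) := by
  rw [coeff_X_pow_mul', splitSum]
  split_ifs with h
  · rw [coeff_mk, Finset.Nat.sum_antidiagonal_eq_sum_range_succ g]
    congr 2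
    omega
  · rw [show n - 1 = 0 by omega, Finset.sum_range_zero]

theorem splitSum_coeff_mul (n : ℕ) (F G : ℚ⟦X⟧) :
    splitSum n (fun j k => coeff j F * coeff k G) = coeff n (X ^ 2 * (F * G)) := by
  rw [splitSum_eq_coeff]
  congr 2
  ext m
  rw [coeff_mk, coeff_mul]

theorem splitSum_coeff_diag (n : ℕ) (F : ℕ → ℚ⟦X⟧) :
    splitSum n (fun j k => coeff j (F k)) = coeff n (X ^ 2 * diagSeries F) :=
  splitSum_eq_coeff _

theorem splitSum_add {R : Type*} [AddCommMonoid R] (n : ℕ) (g g' : ℕ → ℕ → R) :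
    splitSum n (fun j k => g j k + g' j k) = splitSum n g + splitSum n g' :=
  Finset.sum_add_distrib

theorem splitSum_mul {R : Type*} [CommRing R] {n : ℕ} (g : ℕ → ℕ → R) (x : R) :
    splitSum n g * x = splitSum n fun j k => g j k * x := Finset.sum_mul _ _ _

theorem coeff_mergeSeries {n : ℕ} (hn : 1 ≤ n) (W : ℚ⟦X⟧) (b : ℕ) :
    coeff n (mergeSeries W b) = b * coeff (n + b - 2) W := by
  rw [mergeSeries, coeff_mk, if_neg (by omega)]

/-- This coefficient is zero by convention, the loop equations being imposed only for `n ≥ 1`. It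
makes the series of several polygons vanish when the first has no sides. -/
theorem coeff_zero_mergeSeries (W : ℚ⟦X⟧) (b : ℕ) : coeff 0 (mergeSeries W b) = 0 := by
  rw [mergeSeries, coeff_mk, if_pos rfl]

theorem coeff_planarDisk {n : ℕ} (hn : 1 ≤ n) : coeff n planarDisk =
    splitSum n fun j k => coeff j planarDisk * coeff k planarDisk := by
  rw [splitSum_coeff_mul, ← sq]
  conv_lhs => rw [planarDisk_eq]
  rw [map_add, coeff_one, if_neg (by omega), zero_add]

theorem coeff_planarTwo {n : ℕ} (hn : 1 ≤ n) (b : ℕ) : coeff n (planarTwo b) =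
    (splitSum n fun j k => coeff j planarDisk * coeff k (planarTwo b) +
      coeff j (planarTwo b) * coeff k planarDisk) + b * coeff (n + b - 2) planarDisk := by
  rw [splitSum_add, splitSum_coeff_mul, splitSum_coeff_mul, ← coeff_mergeSeries hn, ← map_add,
    ← map_add, planarTwo, ← invRoot_mul_eq]

theorem coeff_torusOne (n : ℕ) : coeff n torusOne =
    splitSum n fun j k => coeff j (planarTwo k) + coeff j planarDisk * coeff k torusOne +
      coeff j torusOne * coeff k planarDisk := by
  rw [splitSum_add, splitSum_add, splitSum_coeff_mul, splitSum_coeff_mul, splitSum_coeff_diag,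
    ← map_add, ← map_add]
  congr 1
  conv_lhs => rw [torusOne, invRoot_mul_eq, ← torusOne]
  ring

theorem coeff_planarThree {n : ℕ} (hn : 1 ≤ n) (b c : ℕ) : coeff n (planarThree b c) =
    (splitSum n fun j k => coeff j planarDisk * coeff k (planarThree b c) +
      coeff j (planarThree b c) * coeff k planarDisk +
      coeff j (planarTwo b) * coeff k (planarTwo c) +
      coeff j (planarTwo c) * coeff k (planarTwo b)) +
    b * coeff (n + b - 2) (planarTwo c) + c * coeff (n + c - 2) (planarTwo b) := by
  rw [splitSum_add, splitSum_add, splitSum_add, splitSum_coeff_mul, splitSum_coeff_mul,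
    splitSum_coeff_mul, splitSum_coeff_mul, ← coeff_mergeSeries hn, ← coeff_mergeSeries hn]
  simp only [← map_add]
  congr 1
  conv_lhs => rw [planarThree, invRoot_mul_eq, ← planarThree]
  ring

theorem coeff_torusTwo {n : ℕ} (hn : 1 ≤ n) (b : ℕ) : coeff n (torusTwo b) =
    (splitSum n fun j k => coeff j (planarThree k b) + coeff j planarDisk * coeff k (torusTwo b) +
      coeff j (torusTwo b) * coeff k planarDisk + coeff j torusOne * coeff k (planarTwo b) +
      coeff j (planarTwo b) * coeff k torusOne) + b * coeff (n + b - 2) torusOne := by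
  rw [splitSum_add, splitSum_add, splitSum_add, splitSum_add, splitSum_coeff_mul,
    splitSum_coeff_mul, splitSum_coeff_mul, splitSum_coeff_mul,
    splitSum_coeff_diag n fun k => planarThree k b, ← coeff_mergeSeries hn]
  simp only [← map_add]
  congr 1
  conv_lhs => rw [torusTwo, invRoot_mul_eq, ← torusTwo]
  ring

theorem coeff_genusTwoOne (n : ℕ) : coeff n genusTwoOne =
    splitSum n fun j k => coeff j (torusTwo k) + coeff j planarDisk * coeff k genusTwoOne +
      coeff j genusTwoOne * coeff k planarDisk + coeff j torusOne * coeff k torusOne := by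
  rw [splitSum_add, splitSum_add, splitSum_add, splitSum_coeff_mul, splitSum_coeff_mul,
    splitSum_coeff_mul, splitSum_coeff_diag]
  simp only [← map_add]
  congr 1
  conv_lhs => rw [genusTwoOne, invRoot_mul_eq, ← genusTwoOne]
  ring

section Ring

variable {R : Type*} [CommRing R] [Algebra ℚ R] (y : R)

/-- The sum over all gluings of one polygon with `n` sides, modulo genus three. -/
noncomputable def one (n : ℕ) : R :=
  algebraMap ℚ R (coeff n planarDisk) + algebraMap ℚ R (coeff n torusOne) * y +
    algebraMap ℚ R (coeff n genusTwoOne) * y ^ 2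

/-- The sum over all connected gluings of two polygons with `n` and `b` sides, modulo genus two. -/
noncomputable def two (n b : ℕ) : R :=
  algebraMap ℚ R (coeff n (planarTwo b)) * y + algebraMap ℚ R (coeff n (torusTwo b)) * y ^ 2

/-- The sum over all connected gluings of three polygons, modulo genus one. -/
noncomputable def three (n b c : ℕ) : R := algebraMap ℚ R (coeff n (planarThree b c)) * y ^ 2

theorem algebraMap_splitSum (n : ℕ) (g : ℕ → ℕ → ℚ) :
    algebraMap ℚ R (splitSum n g) = splitSum n fun j k => algebraMap ℚ R (g j k) :=
  map_sum _ _ _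

/-- The coefficients of `1`, `y` and `y ^ 2` match by the series identities above; the multipliers
of `hy` collect the products of higher order. `genusTwoOne` is needed only to make `u_eq` hold in
order `y ^ 2`. -/
theorem loopEquations (hy : y ^ 3 = 0) : LoopEquations (one y) (two y) (three y) y where
  u_zero := by
    have h1 := coeff_torusOne 0
    have h2 := coeff_genusTwoOne 0
    simp only [splitSum, Nat.zero_sub, Finset.sum_range_zero] at h1 h2
    simp only [one, h1, h2, coeff_zero_eq_constantCoeff, constantCoeff_planarDisk]
    simp
  v_zero b := by
    have h := coeff_zero_mergeSeries
    simp only [coeff_zero_eq_constantCoeff] at h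
    simp [two, planarTwo, torusTwo, h]
  κ_zero b c := by
    have h := coeff_zero_mergeSeries
    simp only [coeff_zero_eq_constantCoeff] at h
    simp [three, planarThree, h]
  u_eq n hn := by
    rw [one, coeff_planarDisk hn, coeff_torusOne, coeff_genusTwoOne, algebraMap_splitSum,
      algebraMap_splitSum, algebraMap_splitSum, splitSum_mul, splitSum_mul, ← splitSum_add,
      ← splitSum_add]
    refine Finset.sum_congr rfl fun j _ => ?_
    simp only [one, two, map_add, map_mul]
    generalize n - 2 - j = k
    linear_combination (-(algebraMap ℚ R (coeff j torusOne) * algebraMap ℚ R (coeff k genusTwoOne) +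
      algebraMap ℚ R (coeff j genusTwoOne) * algebraMap ℚ R (coeff k torusOne) +
      algebraMap ℚ R (coeff j genusTwoOne) * algebraMap ℚ R (coeff k genusTwoOne) * y)) * hy
  v_eq n b hn := by
    rw [two, coeff_planarTwo hn, coeff_torusTwo hn, map_add, map_add, algebraMap_splitSum,
      algebraMap_splitSum, add_mul, add_mul, splitSum_mul, splitSum_mul, map_mul, map_mul,
      map_natCast]
    -- Regroups by type of term instead of by power of `y`: splitting terms with splitting terms,
    -- merging terms with merging terms.
    have : ∀ a b c d e f : R, a + b = c → d + e = f → (a + d) + (b + e) = c + f := by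
      intro a b c d e f h h'
      rw [← h, ← h']
      ring
    refine this _ _ _ _ _ _ ?_ ?_
    · rw [← splitSum_add]
      refine Finset.sum_congr rfl fun j _ => ?_
      simp only [one, two, three, map_add, map_mul]
      generalize n - 2 - j = k
      set A := algebraMap ℚ R
      linear_combination (-(A (coeff j torusOne) * A (coeff k (torusTwo b)) +
        A (coeff j genusTwoOne) * A (coeff k (planarTwo b)) +
        A (coeff j genusTwoOne) * A (coeff k (torusTwo b)) * y +
        A (coeff k torusOne) * A (coeff j (torusTwo b)) +
        A (coeff k genusTwoOne) * A (coeff j (planarTwo b)) +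
        A (coeff k genusTwoOne) * A (coeff j (torusTwo b)) * y)) * hy
    · rw [one]
      linear_combination (-(b * algebraMap ℚ R (coeff (n + b - 2) genusTwoOne))) * hy
  κ_eq n b c hn := by
    rw [three, coeff_planarThree hn, map_add, map_add, algebraMap_splitSum, add_mul, add_mul,
      splitSum_mul, map_mul, map_mul, map_natCast, map_natCast]
    congr 1
    · congr 1
      · refine Finset.sum_congr rfl fun j _ => ?_
        simp only [one, two, three, map_add, map_mul]
        generalize n - 2 - j = k
        set A := algebraMap ℚ R
        linear_combination (-(A (coeff k (planarThree b c)) * (A (coeff j torusOne) +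
          A (coeff j genusTwoOne) * y) + A (coeff j (planarThree b c)) * (A (coeff k torusOne) +
          A (coeff k genusTwoOne) * y) +
          A (coeff j (planarTwo b)) * A (coeff k (torusTwo c)) +
          A (coeff j (torusTwo b)) * A (coeff k (planarTwo c)) +
          A (coeff j (torusTwo b)) * A (coeff k (torusTwo c)) * y +
          A (coeff j (planarTwo c)) * A (coeff k (torusTwo b)) +
          A (coeff j (torusTwo c)) * A (coeff k (planarTwo b)) +
          A (coeff j (torusTwo c)) * A (coeff k (torusTwo b)) * y)) * hy
      · rw [two]
        linear_combination (-(b * algebraMap ℚ R (coeff (n + b - 2) (torusTwo c)))) * hy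
    · rw [two]
      linear_combination (-(c * algebraMap ℚ R (coeff (n + c - 2) (torusTwo b)))) * hy
  v_mul_κ a b c d e := by
    rw [two, three]
    linear_combination (algebraMap ℚ R (coeff c (planarThree d e)) *
      (algebraMap ℚ R (coeff a (planarTwo b)) + algebraMap ℚ R (coeff a (torusTwo b)) * y)) * hy
  κ_mul_κ a b c d e f := by
    rw [three, three]
    linear_combination (algebraMap ℚ R (coeff a (planarThree b c)) *
      algebraMap ℚ R (coeff d (planarThree e f)) * y) * hy
  y_mul_κ a b c := by
    rw [three]
    linear_combination algebraMap ℚ R (coeff a (planarThree b c)) * hy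

end Ring

end Correlator

/-! ### Closed forms after summing over the distribution of sides -/

namespace Correlator

open PowerSeries

theorem coeff_diagSeries (F : ℕ → ℚ⟦X⟧) (n : ℕ) :
    coeff n (diagSeries F) = ∑ b ∈ Finset.range (n + 1), coeff (n - b) (F b) := by
  rw [diagSeries, coeff_mk, ← Finset.Nat.sum_antidiagonal_eq_sum_range_succ
    (fun b a => coeff a (F b)), ← Finset.Nat.sum_antidiagonal_swap]
  rfl

theorem coeff_diagSeries_eq_sum (F : ℕ → ℚ⟦X⟧) {n m : ℕ} (h : n < m) :
    coeff n (diagSeries F) = ∑ b ∈ Finset.range m, coeff n (X ^ b * F b) := by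
  rw [coeff_diagSeries, ← Finset.sum_subset (Finset.range_mono h)]
  · refine Finset.sum_congr rfl fun b hb => ?_
    rw [coeff_X_pow_mul', if_pos (by simpa [Nat.lt_succ_iff] using hb)]
  · intro b _ hb
    rw [coeff_X_pow_mul', if_neg (by simpa [Nat.lt_succ_iff] using hb)]

/-- Up to any given degree the diagonal sum is a finite sum of `X ^ b * F b`, hence linear over
power series. This lets `invRoot` be pulled out of every sum over `b`. -/
theorem diagSeries_mul (G : ℚ⟦X⟧) (F : ℕ → ℚ⟦X⟧) :
    diagSeries (fun b => G * F b) = G * diagSeries F := by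
  ext n
  rw [coeff_diagSeries_eq_sum _ n.lt_succ_self, coeff_mul]
  have : ∀ p ∈ Finset.HasAntidiagonal.antidiagonal n, coeff p.1 G * coeff p.2 (diagSeries F) =
      ∑ b ∈ Finset.range (n + 1), coeff p.1 G * coeff p.2 (X ^ b * F b) := by
    intro p hp
    rw [coeff_diagSeries_eq_sum F (m := n + 1), Finset.mul_sum]
    have := Finset.HasAntidiagonal.mem_antidiagonal.1 hp
    omega
  rw [Finset.sum_congr rfl this, Finset.sum_comm]
  refine Finset.sum_congr rfl fun b _ => ?_
  rw [← coeff_mul]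
  congr 1
  ring

theorem diagSeries_add (F G : ℕ → ℚ⟦X⟧) :
    diagSeries (fun b => F b + G b) = diagSeries F + diagSeries G := by
  ext n
  simp only [coeff_diagSeries, map_add, Finset.sum_add_distrib]

theorem diagSeries_comm (F : ℕ → ℕ → ℚ⟦X⟧) :
    diagSeries (fun c => diagSeries fun b => F b c) =
      diagSeries (fun b => diagSeries fun c => F b c) := by
  ext n
  simp only [coeff_diagSeries]
  rw [Finset.sum_comm' (t' := Finset.range (n + 1)) (s' := fun b => Finset.range (n - b + 1))]
  · refine Finset.sum_congr rfl fun b _ => Finset.sum_congr rfl fun c _ => ?_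
    congr 2
    omega
  · intro c b
    simp only [Finset.mem_range]
    omega

/-- On the diagonal the index `(n - b) + b - 2` does not depend on `b`, so the factors `b < n`
simply add up to a binomial coefficient. -/
theorem diagSeries_mergeSeries (W : ℚ⟦X⟧) :
    diagSeries (mergeSeries W) = mk fun n => (n.choose 2 : ℚ) * coeff (n - 2) W := by
  ext n
  rw [coeff_diagSeries, coeff_mk, Finset.sum_range_succ, Nat.sub_self, coeff_zero_mergeSeries,
    add_zero]
  have : ∀ b ∈ Finset.range n, coeff (n - b) (mergeSeries W b) = b * coeff (n - 2) W := by
    intro b hb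
    rw [Finset.mem_range] at hb
    rw [coeff_mergeSeries (by omega)]
    congr 3
    omega
  rw [Finset.sum_congr rfl this, ← Finset.sum_mul, ← Nat.cast_sum, Finset.sum_range_id,
    Nat.choose_two_right]

theorem two_mul_mk_choose_two (W : ℚ⟦X⟧) :
    2 * (mk fun n => (n.choose 2 : ℚ) * coeff (n - 2) W) =
      X ^ 2 * d⁄dX ℚ (d⁄dX ℚ (X ^ 2 * W)) := by
  ext n
  rw [show (2 : ℚ⟦X⟧) = C (2 : ℚ) from (map_ofNat C 2).symm, coeff_C_mul, coeff_mk,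
    coeff_X_pow_mul']
  split_ifs with h
  · obtain ⟨m, rfl⟩ := Nat.exists_eq_add_of_le h
    rw [Nat.add_sub_cancel_left, coeff_derivative, coeff_derivative, coeff_X_pow_mul',
      if_pos (by omega), show m + 1 + 1 - 2 = m by omega, Nat.cast_choose_two]
    push_cast
    ring
  · rw [Nat.choose_eq_zero_of_lt (by omega)]
    simp

theorem mul_mk_choose_four_eq_derivative (W : ℚ⟦X⟧) :
    24 * (mk fun n => ((n + 2).choose 4 : ℚ) * coeff (n - 2) W) =
      X ^ 2 * d⁄dX ℚ (d⁄dX ℚ (d⁄dX ℚ (d⁄dX ℚ (X ^ 4 * W)))) := by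
  ext n
  rw [show (24 : ℚ⟦X⟧) = C (24 : ℚ) from (map_ofNat C 24).symm, coeff_C_mul, coeff_mk,
    coeff_X_pow_mul']
  split_ifs with h
  · obtain ⟨m, rfl⟩ := Nat.exists_eq_add_of_le h
    rw [Nat.add_sub_cancel_left]
    simp only [coeff_derivative]
    rw [coeff_X_pow_mul', if_pos (by omega), show m + 1 + 1 + 1 + 1 - 4 = m by omega]
    have h1 := Nat.descFactorial_eq_factorial_mul_choose (m + 4) 4
    have h2 : (((m + 4).descFactorial 4 : ℕ) : ℚ) = (m + 4) * (m + 3) * (m + 2) * (m + 1) := by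
      simp only [Nat.descFactorial_succ, Nat.descFactorial_zero]
      rw [show m + 4 - 3 = m + 1 by omega, show m + 4 - 2 = m + 2 by omega,
        show m + 4 - 1 = m + 3 by omega]
      push_cast [Nat.sub_zero]
      ring
    have h3 : (24 : ℚ) * ((m + 4).choose 4 : ℕ) = (m + 4) * (m + 3) * (m + 2) * (m + 1) := by
      rw [← h2, h1]
      push_cast [Nat.factorial]
      ring
    rw [show 2 + m + 2 = m + 4 by ring]
    push_cast
    linear_combination coeff m W * h3
  · rw [Nat.choose_eq_zero_of_lt (by omega)]
    simp

theorem X_sq_mul_planarDisk : 2 * (X ^ 2 * planarDisk) = 1 - root := by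
  rw [root]
  ring

theorem derivative_X_pow_mul_invRoot_pow (m n : ℕ) :
    d⁄dX ℚ (X ^ m * invRoot ^ n) =
      (m : ℚ) • (X ^ (m - 1) * invRoot ^ n) + (4 * n : ℚ) • (X ^ (m + 1) * invRoot ^ (n + 2)) := by
  rw [Derivation.leibniz, derivative_invRoot_pow, derivative_pow, derivative_X, smul_eq_mul,
    smul_eq_mul, smul_eq_C_mul, smul_eq_C_mul, map_mul, map_natCast, map_natCast, map_ofNat]
  ring

theorem derivative_derivative_root : d⁄dX ℚ (d⁄dX ℚ root) = (-4 : ℚ) • invRoot ^ 3 := by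
  rw [show d⁄dX ℚ root = (-4 : ℚ) • (X ^ 1 * invRoot ^ 1) by
    rw [derivative_root, smul_eq_C_mul, map_neg, map_ofNat]; ring]
  rw [Derivation.map_smul, derivative_X_pow_mul_invRoot_pow]
  norm_num
  simp only [smul_eq_C_mul, map_ofNat]
  linear_combination 4 * invRoot * invRoot_sq_mul

/-- The binomial factor is a second derivative of `X ^ 2 * planarDisk = (1 - root) / 2`, and `root`
has second derivative `-4 * invRoot ^ 3`. -/
theorem diagSeries_planarTwo : diagSeries planarTwo = X ^ 2 * invRoot ^ 4 := by
  have h1 : diagSeries planarTwo = invRoot * diagSeries (mergeSeries planarDisk) :=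
    diagSeries_mul _ _
  have h2 := two_mul_mk_choose_two planarDisk
  have h3 := congrArg (fun f => d⁄dX ℚ (d⁄dX ℚ f)) X_sq_mul_planarDisk
  have h5 : ∀ f : ℚ⟦X⟧, 2 * f = (2 : ℚ) • f := fun f => by rw [smul_eq_C_mul, map_ofNat]
  simp only [h5, Derivation.map_smul, map_sub, Derivation.map_one_eq_zero,
    derivative_derivative_root, map_zero] at h3
  rw [h1, diagSeries_mergeSeries]
  have h4 : (4 : ℚ⟦X⟧) * (invRoot * mk fun n => (n.choose 2 : ℚ) * coeff (n - 2) planarDisk) =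
      4 * (X ^ 2 * invRoot ^ 4) := by
    simp only [smul_eq_C_mul, map_ofNat, map_neg] at h3
    linear_combination 2 * invRoot * h2 + X ^ 2 * invRoot * h3
  have := algebraRat.charZero ℚ⟦X⟧
  exact mul_left_cancel₀ (OfNat.ofNat_ne_zero 4) h4

theorem torusOne_eq : torusOne = X ^ 4 * invRoot ^ 5 := by
  rw [torusOne, diagSeries_planarTwo]
  ring

theorem mk_choose_four_planarDisk :
    (mk fun n => ((n + 2).choose 4 : ℚ) * coeff (n - 2) planarDisk) =
      X ^ 2 * (invRoot ^ 3 + 9 * X ^ 2 * invRoot ^ 5 + 20 * X ^ 4 * invRoot ^ 7) := by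
  have h2 := mul_mk_choose_four_eq_derivative planarDisk
  -- Only `root` and powers of `invRoot` remain to be differentiated; the factor `invRoot ^ 0` puts
  -- `X ^ 2` into the shape of `derivative_X_pow_mul_invRoot_pow`.
  have hA : X ^ 4 * planarDisk = (1 / 2 : ℚ) • (X ^ 2 * invRoot ^ 0) +
      (-1 / 2 : ℚ) • (X ^ 2 * root) := by
    have h : (2 : ℚ) • (X ^ 4 * planarDisk) = (2 : ℚ) • ((1 / 2 : ℚ) • (X ^ 2 * invRoot ^ 0) +
      (-1 / 2 : ℚ) • (X ^ 2 * root)) := by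
      rw [smul_add, smul_smul, smul_smul]
      norm_num
      rw [smul_eq_C_mul, map_ofNat]
      linear_combination X ^ 2 * X_sq_mul_planarDisk
    exact smul_right_injective _ (by norm_num : (2 : ℚ) ≠ 0) h
  have hroot : d⁄dX ℚ (d⁄dX ℚ (X ^ 2 * root)) = (2 : ℚ) • root +
      (-16 : ℚ) • (X ^ 2 * invRoot ^ 1) + (-4 : ℚ) • (X ^ 2 * invRoot ^ 3) := by
    rw [Derivation.leibniz, map_add, smul_eq_mul, smul_eq_mul, Derivation.leibniz,
      Derivation.leibniz, derivative_derivative_root, derivative_root, derivative_pow, derivative_X]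
    simp only [smul_eq_C_mul, map_ofNat, map_neg, smul_eq_mul, Derivation.leibniz, derivative_X,
      Nat.cast_ofNat, mul_one, Nat.add_one_sub_one, pow_one]
    have h4 : d⁄dX ℚ (2 : ℚ⟦X⟧) = 0 := by rw [← map_ofNat C 2, derivative_C]
    rw [h4]
    ring
  have hroot' : d⁄dX ℚ root = (-4 : ℚ) • (X ^ 1 * invRoot ^ 1) := by
    rw [derivative_root, smul_eq_C_mul, map_neg, map_ofNat]
    ring
  simp only [hA, map_add, Derivation.map_smul, hroot, derivative_X_pow_mul_invRoot_pow, hroot'] at h2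
  norm_num at h2
  simp only [smul_smul] at h2
  norm_num at h2
  simp only [smul_eq_C_mul, map_ofNat] at h2
  have h6 : (24 : ℚ⟦X⟧) * (mk fun n => ((n + 2).choose 4 : ℚ) * coeff (n - 2) planarDisk) =
      24 * (X ^ 2 * (invRoot ^ 3 + 9 * X ^ 2 * invRoot ^ 5 + 20 * X ^ 4 * invRoot ^ 7)) := by
    linear_combination h2 + X ^ 2 * (-20 * invRoot - 96 * X ^ 2 * invRoot ^ 3) * invRoot_sq_mul
  have := algebraRat.charZero ℚ⟦X⟧
  exact mul_left_cancel₀ (OfNat.ofNat_ne_zero 24) h6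

/-- Hockey-stick summation, as `(b + 2).choose 2 * b = 3 * (b + 2).choose 3`. -/
theorem sum_choose_two_mul (n : ℕ) :
    ∑ b ∈ Finset.range n, (b + 2).choose 2 * b = 3 * (n + 2).choose 4 := by
  induction n with
  | zero => rfl
  | succ n ih =>
    rw [Finset.sum_range_succ, ih, show n + 1 + 2 = (n + 2) + 1 by ring,
      Nat.choose_succ_succ' (n + 2) 3]
    have : (n + 2).choose 3 * 3 = (n + 2).choose 2 * n := Nat.choose_succ_right_eq (n + 2) 2
    rw [show 3 + 1 = 4 from rfl]
    omega

theorem diagSeries_choose_mul_mergeSeries :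
    diagSeries (fun b => C ((b + 2).choose 2 : ℚ) * mergeSeries planarDisk b) =
      3 * mk fun n => ((n + 2).choose 4 : ℚ) * coeff (n - 2) planarDisk := by
  ext n
  rw [coeff_diagSeries, show (3 : ℚ⟦X⟧) = C (3 : ℚ) from (map_ofNat C 3).symm, coeff_C_mul, coeff_mk,
    Finset.sum_range_succ, Nat.sub_self, coeff_C_mul, coeff_zero_mergeSeries, mul_zero, add_zero]
  have : ∀ b ∈ Finset.range n, coeff (n - b) (C ((b + 2).choose 2 : ℚ) * mergeSeries planarDisk b) =
      (((b + 2).choose 2 * b : ℕ) : ℚ) * coeff (n - 2) planarDisk := by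
    intro b hb
    rw [Finset.mem_range] at hb
    rw [coeff_C_mul, coeff_mergeSeries (by omega), Nat.cast_mul, mul_assoc]
    congr 4
    omega
  rw [Finset.sum_congr rfl this, ← Finset.sum_mul, ← Nat.cast_sum, sum_choose_two_mul]
  push_cast
  ring

/-- The inner sum leaves a binomial weight depending on the first index of `planarTwo`. Symmetry
moves the weight to the second index, where it is a constant factor and the definition of
`planarTwo` reduces everything to `planarDisk`. -/
theorem diagSeries_mergeSeries_planarTwo
    (hsymm : ∀ a b, coeff a (planarTwo b) = coeff b (planarTwo a)) :
    diagSeries (fun c => diagSeries (mergeSeries (planarTwo c))) = X ^ 2 * (invRoot *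
      (3 * mk fun n => ((n + 2).choose 4 : ℚ) * coeff (n - 2) planarDisk)) := by
  rw [← diagSeries_choose_mul_mergeSeries, ← diagSeries_mul]
  ext n
  rw [coeff_X_pow_mul', coeff_diagSeries]
  simp only [diagSeries_mergeSeries, coeff_mk]
  split_ifs with h
  · obtain ⟨m, rfl⟩ := Nat.exists_eq_add_of_le' h
    rw [Finset.sum_range_succ, Finset.sum_range_succ, Nat.choose_eq_zero_of_lt (n := m + 2 - (m + 2))
      (by omega), Nat.choose_eq_zero_of_lt (n := m + 2 - (m + 1)) (by omega), Nat.add_sub_cancel,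
      coeff_diagSeries, ← Finset.sum_range_reflect]
    simp only [Nat.cast_zero, zero_mul, add_zero]
    refine Finset.sum_congr rfl fun b hb => ?_
    rw [Finset.mem_range] at hb
    rw [mul_left_comm, coeff_C_mul, ← planarTwo, hsymm (m - b)]
    rw [show m + 2 - (m + 1 - 1 - b) = b + 2 by omega, show m + 1 - 1 - b = m - b by omega,
      Nat.add_sub_cancel]
  · refine Finset.sum_eq_zero fun c _ => ?_
    rw [Nat.choose_eq_zero_of_lt (by omega), Nat.cast_zero, zero_mul]

/-- The two merging terms have equal double sums, by exchanging the order of summation. -/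
theorem diagSeries_planarThree
    (hsymm : ∀ a b, coeff a (planarTwo b) = coeff b (planarTwo a)) :
    diagSeries (fun c => diagSeries fun b => planarThree b c) =
      invRoot * (2 * X ^ 6 * invRoot ^ 8 + 6 * X ^ 4 * invRoot *
        (invRoot ^ 3 + 9 * X ^ 2 * invRoot ^ 5 + 20 * X ^ 4 * invRoot ^ 7)) := by
  have h := diagSeries_mergeSeries_planarTwo hsymm
  rw [mk_choose_four_planarDisk] at h
  have h1 : ∀ c, diagSeries (fun b => planarThree b c) =
      invRoot * (2 * X ^ 2 * diagSeries planarTwo * planarTwo c +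
        diagSeries (mergeSeries (planarTwo c)) +
        diagSeries fun b => mergeSeries (planarTwo b) c) := by
    intro c
    simp only [planarThree]
    rw [diagSeries_mul, diagSeries_add, diagSeries_add]
    congr 3
    rw [mul_right_comm, ← diagSeries_mul]
    congr 1
    ext1 b
    ring
  simp only [h1]
  rw [diagSeries_mul, diagSeries_add, diagSeries_add, diagSeries_mul, h,
    diagSeries_comm fun b c => mergeSeries (planarTwo b) c, h, diagSeries_planarTwo]
  ring

/-- Sum the definition of `torusTwo` over `b`; the relation `invRoot ^ 2 * (1 - 4 * X ^ 2) = 1` then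
brings all terms to the common power `invRoot ^ 10`. -/
theorem diagSeries_torusTwo
    (hsymm : ∀ a b, coeff a (planarTwo b) = coeff b (planarTwo a)) :
    diagSeries torusTwo = (21 * X ^ 6 + 20 * X ^ 8) * invRoot ^ 10 := by
  have h1 : diagSeries torusTwo = invRoot *
      (X ^ 2 * diagSeries (fun c => diagSeries fun b => planarThree b c) +
        2 * X ^ 2 * torusOne * diagSeries planarTwo + diagSeries (mergeSeries torusOne)) := by
    have h : torusTwo = fun b => invRoot * (X ^ 2 * diagSeries (fun k => planarThree k b) +
        2 * X ^ 2 * torusOne * planarTwo b + mergeSeries torusOne b) := rfl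
    rw [h, diagSeries_mul, diagSeries_add, diagSeries_add, diagSeries_mul, diagSeries_mul]
  have h2 := two_mul_mk_choose_two torusOne
  rw [torusOne_eq, show X ^ 2 * (X ^ 4 * invRoot ^ 5) = X ^ 6 * invRoot ^ 5 by ring] at h2
  simp only [derivative_X_pow_mul_invRoot_pow, map_add, Derivation.map_smul] at h2
  norm_num at h2
  simp only [smul_smul] at h2
  norm_num at h2
  simp only [smul_eq_C_mul, map_ofNat] at h2
  rw [h1, diagSeries_planarThree hsymm, diagSeries_planarTwo, diagSeries_mergeSeries, torusOne_eq]
  have h3 : (2 : ℚ⟦X⟧) * (invRoot *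
      (X ^ 2 * (invRoot * (2 * X ^ 6 * invRoot ^ 8 + 6 * X ^ 4 * invRoot *
        (invRoot ^ 3 + 9 * X ^ 2 * invRoot ^ 5 + 20 * X ^ 4 * invRoot ^ 7))) +
      2 * X ^ 2 * (X ^ 4 * invRoot ^ 5) * (X ^ 2 * invRoot ^ 4) +
      mk fun n => (n.choose 2 : ℚ) * coeff (n - 2) (X ^ 4 * invRoot ^ 5))) =
      2 * ((21 * X ^ 6 + 20 * X ^ 8) * invRoot ^ 10) := by
    linear_combination invRoot * h2 - 2 * invRoot * (21 * X ^ 6 * invRoot ^ 5 +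
      (21 * X ^ 6 + 100 * X ^ 8) * invRoot ^ 7) * invRoot_sq_mul
  have := algebraRat.charZero ℚ⟦X⟧
  exact mul_left_cancel₀ two_ne_zero h3

/-- The negative binomial series of `(1 - 4 * X ^ 2) ^ (-5)`. -/
theorem coeff_invRoot_pow_ten (n : ℕ) :
    coeff (2 * n) (invRoot ^ 10) = 4 ^ n * ((n + 4).choose 4 : ℚ) := by
  have h := congrArg (fun f => expand 2 two_ne_zero (rescale (4 : ℚ) f))
    (mk_add_choose_mul_one_sub_pow_eq_one ℚ 4)
  simp only [map_mul, map_pow, map_sub, map_one, rescale_X, expand_X, map_ofNat] at h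
  set E := expand 2 two_ne_zero (rescale (4 : ℚ) (mk fun n => ((4 + n).choose 4 : ℚ))) with hE
  have h1 : invRoot ^ 10 * (1 - 4 * X ^ 2) ^ 5 = 1 := by
    rw [show invRoot ^ 10 = (invRoot ^ 2) ^ 5 by ring, ← mul_pow, invRoot_sq_mul, one_pow]
  have h2 : invRoot ^ 10 = E := by
    linear_combination (-invRoot ^ 10) * h + E * h1
  rw [h2, hE, coeff_expand_mul, coeff_rescale, coeff_mk, add_comm 4 n]

theorem coeff_diagSeries_torusTwo
    (hsymm : ∀ a b, coeff a (planarTwo b) = coeff b (planarTwo a)) (n : ℕ) (hn : 1 ≤ n) :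
    coeff (2 * n) (diagSeries torusTwo) =
      (4 : ℚ) ^ ((n : ℤ) - 4) *
        ((n : ℚ) * ((n : ℚ) - 1) * ((n : ℚ) - 2) * (13 * (n : ℚ) + 3) / 3) := by
  rw [diagSeries_torusTwo hsymm, add_mul, mul_assoc, mul_assoc,
    show (21 : ℚ⟦X⟧) = C (21 : ℚ) from (map_ofNat C 21).symm,
    show (20 : ℚ⟦X⟧) = C (20 : ℚ) from (map_ofNat C 20).symm, map_add, coeff_C_mul, coeff_C_mul,
    coeff_X_pow_mul', coeff_X_pow_mul']
  have hc : ∀ m : ℕ, ((m + 4).choose 4 : ℚ) = (m + 4) * (m + 3) * (m + 2) * (m + 1) / 24 := by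
    intro m
    induction m with
    | zero => norm_num
    | succ m ih =>
      have h := Nat.add_one_mul_choose_eq (m + 4) 4
      have h' := Nat.choose_succ_right_eq (m + 5) 4
      rw [show m + 5 - 4 = m + 1 by omega] at h'
      have h2 : ((m + 5).choose 4 : ℚ) * (m + 1) = (m + 5) * (m + 4).choose 4 := by
        exact_mod_cast (h'.symm.trans h.symm)
      have hm : (m : ℚ) + 1 ≠ 0 := by positivity
      rw [ih] at h2
      rw [show m + 1 + 4 = m + 5 by ring]
      apply mul_right_cancel₀ hm
      rw [h2]
      push_cast
      ring
  -- Below `4` the exponent `n - 4` is negative and the `X ^ 8` term is absent: both sides are `0`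
  -- for `n = 1, 2` and `21` for `n = 3`.
  obtain rfl | rfl | rfl | ⟨m, rfl⟩ : n = 1 ∨ n = 2 ∨ n = 3 ∨ ∃ m, n = m + 4 := by
    rcases n with _ | _ | _ | _ | m
    · omega
    · simp
    · simp
    · simp
    · exact Or.inr (Or.inr (Or.inr ⟨m, rfl⟩))
  · norm_num
  · norm_num
  · have := coeff_invRoot_pow_ten 0
    norm_num at this ⊢
    rw [this]
  · rw [if_pos (by omega), if_pos (by omega), show 2 * (m + 4) - 6 = 2 * (m + 1) by omega,
      show 2 * (m + 4) - 8 = 2 * m by omega, coeff_invRoot_pow_ten, coeff_invRoot_pow_ten, hc, hc,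
      show ((m + 4 : ℕ) : ℤ) - 4 = (m : ℤ) by push_cast; ring, zpow_natCast]
    push_cast
    ring

end Correlator

/-! ### Polygons as cycles, and separation of the connected gluings -/

section Rotation

theorem IsCyclicWord.map {X Y : Type*} {φ : Equiv.Perm X} {ψ : Equiv.Perm Y} {w : List X}
    (h : IsCyclicWord φ w) (g : X → Y) (hg : ∀ x, ψ (g x) = g (φ x)) :
    IsCyclicWord ψ (w.map g) := by
  obtain ⟨a, l, rfl, hc⟩ := h
  refine ⟨g a, l.map g, rfl, ?_⟩
  have : g a :: (l.map g ++ [g a]) = (a :: (l ++ [a])).map g := by simp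
  rw [this, List.isChain_map]
  exact hc.imp fun x y hxy => by rw [hg, hxy]

theorem isCyclicWord_finRange {n : ℕ} (hn : 0 < n) :
    IsCyclicWord (finRotate n) (List.finRange n) := by
  obtain ⟨n, rfl⟩ : ∃ m, n = m + 1 := ⟨n - 1, by omega⟩
  refine ⟨0, (List.finRange n).map Fin.succ, List.finRange_succ, ?_⟩
  rw [← List.cons_append, ← List.finRange_succ, List.isChain_iff_getElem]
  intro i hi
  simp only [List.length_append, List.length_finRange, List.length_singleton] at hi
  rw [List.getElem_append_left (by simp; omega), finRotate_apply]
  by_cases h : i + 1 < n + 1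
  · rw [List.getElem_append_left (by simpa using h)]
    simp only [List.getElem_finRange, Fin.ext_iff, Fin.val_add, Fin.val_one', Fin.val_cast]
    simp [Nat.mod_eq_of_lt h]
  · rw [List.getElem_append_right (by simp; omega)]
    obtain rfl : i = n := by omega
    simp [Fin.ext_iff, Fin.val_add]

theorem isCycleList_finRotate {n : ℕ} (hn : 0 < n) :
    IsCycleList (finRotate n) [List.finRange n] where
  cyclic w hw := by
    rw [List.mem_singleton] at hw
    exact hw ▸ isCyclicWord_finRange hn
  nodup := by simpa using List.nodup_finRange n
  mem x := by simp

variable {ι : Type*} (s : ι → ℕ)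

/-- The rotation of the sides of all polygons. -/
def sideRotation : Equiv.Perm (Σ i, Fin (s i)) := Equiv.Perm.sigmaCongrRight fun i => finRotate (s i)

/-- The sides of one polygon in their cyclic order. -/
def polygonWord (i : ι) : List (Σ i, Fin (s i)) := (List.finRange (s i)).map (Sigma.mk i)

theorem mem_polygonWord {i : ι} {x : Σ i, Fin (s i)} : x ∈ polygonWord s i ↔ x.1 = i := by
  constructor
  · intro h
    obtain ⟨j, -, rfl⟩ := List.mem_map.1 h
    rfl
  · rintro rfl
    exact List.mem_map.2 ⟨x.2, List.mem_finRange _, rfl⟩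

theorem length_polygonWord (i : ι) : (polygonWord s i).length = s i := by
  simp [polygonWord]

theorem isCycleList_rotation (hs : ∀ i, 0 < s i) (l : List ι) (hl : l.Nodup) (hl' : ∀ i, i ∈ l) :
    IsCycleList (sideRotation s) (l.map (polygonWord s)) where
  cyclic w hw := by
    obtain ⟨i, -, rfl⟩ := List.mem_map.1 hw
    exact (isCyclicWord_finRange (hs i)).map _ fun _ => rfl
  nodup := by
    rw [List.nodup_flatten]
    constructor
    · intro w hw
      obtain ⟨i, -, rfl⟩ := List.mem_map.1 hw
      exact (List.nodup_finRange _).map sigma_mk_injective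
    · rw [List.pairwise_map]
      refine hl.imp fun {i j} hij x hx hx' => hij ?_
      rw [mem_polygonWord] at hx hx'
      exact hx.symm.trans hx'
  mem x := List.mem_flatten_of_mem (List.mem_map.2 ⟨x.1, hl' _, rfl⟩) ((mem_polygonWord s).2 rfl)

theorem countIn_univ {X : Type*} [DecidableEq X] [Fintype X] (w : List X) :
    countIn Finset.univ w = w.length := by simp [countIn]

variable {R : Type*} [CommRing R] {u : ℕ → R} {v : ℕ → ℕ → R} {κ : ℕ → ℕ → ℕ → R} {y : R}

theorem LoopEquations.genusSum_finRotate (H : LoopEquations u v κ y) {n : ℕ} (hn : 0 < n) :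
    GenusSum y (n + 2) Finset.univ (finRotate n) (u n) := by
  have := GenusSum.blockSum H Finset.univ (finRotate n) [] _ (isCycleList_finRotate hn) (by simp)
  simpa [countIn_univ, blockSum_cons, blockSum_nil, pick, pickTwo] using this

theorem LoopEquations.genusSum_rotation (H : LoopEquations u v κ y) {s : Fin 2 → ℕ}
    (hs : ∀ i, 0 < s i) : GenusSum y (s 0 + s 1 + 4) Finset.univ (sideRotation s)
      (u (s 0) * u (s 1) + v (s 0) (s 1)) := by
  have := GenusSum.blockSum H Finset.univ (sideRotation s) [] _
    (isCycleList_rotation s hs [0, 1] (by decide) (by decide)) (by simp)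
  simpa [countIn_univ, blockSum_cons, blockSum_nil, pick, pickTwo, length_polygonWord] using this

/-- The loop equations single out the first polygon, but the weighted count does not depend on the
order in which the cycles are listed. Comparing both orders gives the symmetry. -/
theorem LoopEquations.v_comm (H : LoopEquations u v κ y) {a b : ℕ} (ha : 0 < a) (hb : 0 < b) :
    v a b = v b a := by
  have hs : ∀ i, 0 < ![a, b] i := by simp [Fin.forall_fin_two, ha, hb]
  have h := GenusSum.blockSum H Finset.univ (sideRotation ![a, b]) [] _
    (isCycleList_rotation _ hs [1, 0] (by decide) (by decide)) (by simp)
  have hc : (Finset.univ : Finset (Σ i, Fin (![a, b] i))).card +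
      2 * ([] ++ [1, 0].map (polygonWord ![a, b])).length = ![a, b] 0 + ![a, b] 1 + 4 := by
    simp
  simp only [List.map_cons, List.map_nil] at hc h
  rw [hc] at h
  have h1 := h.2.symm.trans (H.genusSum_rotation hs).2
  simp [countIn_univ, blockSum_cons, blockSum_nil, pick, pickTwo, length_polygonWord] at h1
  linear_combination -h1

theorem numCycles_sigmaCongrRight {ι : Type*} [Fintype ι] {β : ι → Type*} [∀ i, Finite (β i)]
    (γ : ∀ i, Equiv.Perm (β i)) :
    numCycles (Equiv.Perm.sigmaCongrRight γ) = ∑ i, numCycles (γ i) := by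
  simp only [numCycles]
  rw [← Nat.card_sigma]
  refine Nat.card_congr ⟨Quot.lift (fun x => ⟨x.1, Quot.mk _ x.2⟩) ?_,
    fun x => Quot.lift (fun b => Quot.mk _ ⟨x.1, b⟩) ?_ x.2, ?_, ?_⟩
  · rintro ⟨i, x⟩ _ rfl
    exact congrArg (Sigma.mk i) (Quot.sound rfl)
  · rintro b _ rfl
    exact Quot.sound rfl
  · rintro ⟨x⟩
    rfl
  · rintro ⟨i, ⟨x⟩⟩
    rfl

/-- The gluing attaches each polygon to itself only. -/
def PreservesPolygons (α : Equiv.Perm (Σ i, Fin (s i))) : Prop := ∀ e, (α e).1 = e.1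

-- Such a gluing is an independent choice of a matching on each polygon; cycle numbers, and with
-- them the exponents of `y`, add up.
open Classical in
theorem sum_preservesPolygons (H : LoopEquations u v κ y) {s : Fin 2 → ℕ} (hs : ∀ i, 0 < s i) :
    ∑ α ∈ matchings Finset.univ with PreservesPolygons s α,
      y ^ ((s 0 + s 1 + 4 - 2 * numCycles (sideRotation s * α)) / 4) = u (s 0) * u (s 1) := by
  have h1 := fun i => H.genusSum_finRotate (hs i)
  rw [← Fin.prod_univ_two fun i => u (s i)]
  have h2 : ∏ i, u (s i) = ∏ i, ∑ α ∈ matchings (Finset.univ : Finset (Fin (s i))),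
      y ^ ((s i + 2 - 2 * numCycles (finRotate (s i) * α)) / 4) :=
    Finset.prod_congr rfl fun i _ => (h1 i).2.symm
  rw [h2, Finset.prod_univ_sum]
  symm
  refine Finset.sum_bij (fun β _ => Equiv.Perm.sigmaCongrRight β) ?_ ?_ ?_ ?_
  · intro β hβ
    rw [Fintype.mem_piFinset] at hβ
    rw [Finset.mem_filter, mem_matchings]
    refine ⟨⟨?_, ?_⟩, fun e => rfl⟩
    · rintro ⟨i, x⟩
      exact congrArg (Sigma.mk i) ((mem_matchings.1 (hβ i)).1 x)
    · rintro ⟨i, x⟩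
      have := ((mem_matchings.1 (hβ i)).2 x).2 (Finset.mem_univ _)
      refine iff_of_true (fun h => this ?_) (Finset.mem_univ _)
      exact sigma_mk_injective (i := i) h
  · intro β _ β' _ h
    funext i
    ext1 x
    exact sigma_mk_injective (i := i) (congrArg (fun f : Equiv.Perm (Σ i, Fin (s i)) => f ⟨i, x⟩) h)
  · intro α hα
    rw [Finset.mem_filter, mem_matchings] at hα
    obtain ⟨⟨hα, hα'⟩, hp⟩ := hα
    have : ∀ i x, ∃ z, α ⟨i, x⟩ = ⟨i, z⟩ := by
      intro i x
      have := hp ⟨i, x⟩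
      generalize α ⟨i, x⟩ = w at this
      obtain ⟨j, z⟩ := w
      obtain rfl : j = i := this
      exact ⟨z, rfl⟩
    choose f hf using this
    have hinv : ∀ i, Function.Involutive (f i) := fun i x => by
      have := hα ⟨i, x⟩
      rw [hf, hf] at this
      exact sigma_mk_injective (i := i) this
    refine ⟨fun i => (hinv i).toPerm, ?_, ?_⟩
    · rw [Fintype.mem_piFinset]
      intro i
      rw [mem_matchings]
      refine ⟨hinv i, fun x => iff_of_true (fun h => ?_) (Finset.mem_univ _)⟩
      refine (hα' ⟨i, x⟩).2 (Finset.mem_univ _) ?_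
      rw [hf]
      exact congrArg (Sigma.mk i) h
    · ext1 ⟨i, x⟩
      exact (hf i x).symm
  · intro β hβ
    rw [Fintype.mem_piFinset] at hβ
    have h3 : sideRotation s * Equiv.Perm.sigmaCongrRight β =
        Equiv.Perm.sigmaCongrRight fun i => finRotate (s i) * β i := by
      ext1 ⟨i, x⟩
      rfl
    rw [h3, numCycles_sigmaCongrRight, Fin.sum_univ_two, Fin.prod_univ_two, ← pow_add]
    obtain ⟨k, hk⟩ := (h1 0).1 _ (hβ 0)
    obtain ⟨l, hl⟩ := (h1 1).1 _ (hβ 1)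
    congr 1
    omega

open Classical in
theorem sum_not_preservesPolygons (H : LoopEquations u v κ y) {s : Fin 2 → ℕ}
    (hs : ∀ i, 0 < s i) :
    ∑ α ∈ matchings Finset.univ with ¬ PreservesPolygons s α,
      y ^ ((s 0 + s 1 + 4 - 2 * numCycles (sideRotation s * α)) / 4) = v (s 0) (s 1) := by
  have h := (H.genusSum_rotation hs).2
  rw [← Finset.sum_filter_add_sum_filter_not _ (PreservesPolygons s),
    sum_preservesPolygons H hs] at h
  exact add_left_cancel h

end Rotation

/-! ### Extracting coefficients modulo `y ^ 3` -/

namespace Correlator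

open PowerSeries

/-- The ring of truncated polynomials `ℚ[y] / (y ^ 3)`. -/
abbrev Truncated : Type := AdjoinRoot (Polynomial.X ^ 3 : Polynomial ℚ)

/-- The variable of the ring of truncated polynomials. -/
noncomputable abbrev Truncated.var : Truncated := AdjoinRoot.root _

theorem Truncated.var_pow_three : Truncated.var ^ 3 = 0 := by
  have := AdjoinRoot.mk_self (f := (Polynomial.X ^ 3 : Polynomial ℚ))
  rwa [map_pow, AdjoinRoot.mk_X] at this

theorem Truncated.coeff_eq {p q : Polynomial ℚ}
    (h : AdjoinRoot.mk (Polynomial.X ^ 3) p = AdjoinRoot.mk (Polynomial.X ^ 3) q) {i : ℕ}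
    (hi : i < 3) : p.coeff i = q.coeff i := by
  have := Polynomial.X_pow_dvd_iff.1 (AdjoinRoot.mk_eq_mk.1 h) i hi
  rw [Polynomial.coeff_sub] at this
  linarith

theorem two_eq_mk (n b : ℕ) : two Truncated.var n b = AdjoinRoot.mk (Polynomial.X ^ 3)
    (Polynomial.C (coeff n (planarTwo b)) * Polynomial.X +
      Polynomial.C (coeff n (torusTwo b)) * Polynomial.X ^ 2) := by
  rw [two, map_add, map_mul, map_mul, map_pow, AdjoinRoot.mk_X, AdjoinRoot.mk_C, AdjoinRoot.mk_C]
  rfl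

theorem mergeSeries_zero_right (W : ℚ⟦X⟧) : mergeSeries W 0 = 0 := by
  ext n
  simp [mergeSeries]

theorem mergeSeries_zero_left (b : ℕ) : mergeSeries 0 b = 0 := by
  ext n
  simp [mergeSeries]

theorem planarTwo_zero : planarTwo 0 = 0 := by
  rw [planarTwo, mergeSeries_zero_right, mul_zero]

theorem coeff_zero_planarTwo (b : ℕ) : coeff 0 (planarTwo b) = 0 := by
  have h := coeff_zero_mergeSeries planarDisk b
  rw [coeff_zero_eq_constantCoeff] at h ⊢
  simp [planarTwo, h]

theorem torusTwo_zero : torusTwo 0 = 0 := by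
  have h : ∀ k, planarThree k 0 = 0 := fun k => by
    rw [planarThree, planarTwo_zero, mergeSeries_zero_right, mergeSeries_zero_left]
    ring
  have h' : diagSeries (fun _ => 0) = 0 := by
    ext n
    simp [diagSeries]
  simp only [torusTwo, h, h', planarTwo_zero, mergeSeries_zero_right]
  ring

theorem coeff_zero_torusTwo (b : ℕ) : coeff 0 (torusTwo b) = 0 := by
  have h := coeff_zero_mergeSeries torusOne b
  rw [coeff_zero_eq_constantCoeff] at h ⊢
  simp [torusTwo, h]

/-- The coefficient of `y` in `v_comm`; a polygon without sides is treated apart, since `v_comm`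
concerns positive numbers of sides. -/
theorem coeff_planarTwo_comm (a b : ℕ) : coeff a (planarTwo b) = coeff b (planarTwo a) := by
  rcases Nat.eq_zero_or_pos a with rfl | ha
  · rw [planarTwo_zero, coeff_zero_planarTwo, map_zero]
  rcases Nat.eq_zero_or_pos b with rfl | hb
  · rw [planarTwo_zero, coeff_zero_planarTwo, map_zero]
  have h := (loopEquations _ Truncated.var_pow_three).v_comm ha hb
  rw [two_eq_mk, two_eq_mk] at h
  simpa [Polynomial.coeff_X_pow] using Truncated.coeff_eq h (i := 1) (by norm_num)

-- For two polygons connected to each other the exponent of `y` is the genus plus one, so the torus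
-- is the coefficient of `y ^ 2`.
open Classical in
theorem card_matchings_eq_coeff_torusTwo {s : Fin 2 → ℕ} (hs : ∀ i, 0 < s i) :
    (((matchings Finset.univ).filter fun α => ¬ PreservesPolygons s α ∧
      s 0 + s 1 = 2 * numCycles (sideRotation s * α) + 4).card : ℚ) =
      coeff (s 0) (torusTwo (s 1)) := by
  have H := loopEquations _ Truncated.var_pow_three
  have h := sum_not_preservesPolygons H hs
  rw [two_eq_mk, show Truncated.var = AdjoinRoot.mk _ Polynomial.X from AdjoinRoot.mk_X.symm] at h
  simp only [← map_pow, ← map_sum] at h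
  have h2 := Truncated.coeff_eq h (i := 2) (by norm_num)
  simp only [Polynomial.finsetSum_coeff, Polynomial.coeff_X_pow, Polynomial.coeff_add,
    Polynomial.coeff_C_mul, Polynomial.coeff_X] at h2
  norm_num at h2
  rw [← h2, Finset.filter_filter]
  norm_cast
  congr 1
  refine Finset.filter_congr fun α hα => and_congr_right fun _ => ?_
  obtain ⟨k, hk⟩ := (H.genusSum_rotation hs).1 α hα
  omega

end Correlator

/-! ### From gluings to matchings -/

namespace PolygonGluing

/-- The first point of `e` is glued to the last point of its partner, which is the image of `e`
under `φ * α`. The other kind of identification is the same one read from the partner. -/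
theorem card_vertex {N K : ℕ} (P : PolygonGluing N K) :
    Nat.card P.Vertex = numCycles (sideRotation P.sides * P.glue) := by
  refine Nat.card_congr ⟨Quot.lift (Quot.mk _) ?_, Quot.lift (Quot.mk _) ?_, ?_, ?_⟩
  · rintro c d ⟨e, ⟨rfl, rfl⟩ | ⟨rfl, rfl⟩⟩
    · exact Quot.sound rfl
    · refine (Quot.sound ?_).symm
      change sideRotation P.sides (P.glue (P.glue e)) = _
      rw [P.glue_glue]
      rfl
  · rintro c _ rfl
    exact Quot.sound ⟨c, Or.inl ⟨rfl, rfl⟩⟩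
  · rintro ⟨x⟩
    rfl
  · rintro ⟨x⟩
    rfl

theorem isConnected_two_iff {N : ℕ} (P : PolygonGluing N 2) :
    P.IsConnected ↔ ¬ PreservesPolygons P.sides P.glue := by
  constructor
  · intro h hp
    have h01 : (0 : Fin 2) ≠ 1 := by decide
    obtain ⟨w⟩ := h.preconnected 0 1
    cases w with
    | cons hadj _ =>
      obtain ⟨hne, ⟨e, h1, h2⟩ | ⟨e, h1, h2⟩⟩ := hadj
      · exact hne (by rw [← h1, ← h2, hp e])
      · exact hne (by rw [← h1, ← h2, hp e])
  · intro h
    rw [PreservesPolygons] at h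
    push Not at h
    obtain ⟨e, he⟩ := h
    have hadj : P.polygonGraph.Adj e.1 (P.glue e).1 :=
      ⟨Ne.symm he, Or.inl ⟨e, rfl, rfl⟩⟩
    refine ⟨fun i j => ?_⟩
    have key : ∀ i, P.polygonGraph.Reachable e.1 i := by
      intro i
      by_cases hi : i = e.1
      · rw [hi]
      · have : i = (P.glue e).1 := by
          have h1 := Ne.symm he
          generalize (P.glue e).1 = b at *
          generalize e.1 = a at *
          omega
        rw [this]
        exact hadj.reachable
    exact (key i).symm.trans (key j)

theorem hasGenus_one_iff {N : ℕ} (P : PolygonGluing N 2) :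
    P.HasGenus 1 ↔ ¬ PreservesPolygons P.sides P.glue ∧
      P.sides 0 + P.sides 1 = 2 * numCycles (sideRotation P.sides * P.glue) + 4 := by
  have h := P.sum_sides
  rw [Fin.sum_univ_two] at h
  rw [HasGenus, isConnected_two_iff, eulerChar, card_vertex]
  refine and_congr_right fun _ => ?_
  push_cast
  omega

open Classical in
/-- Gluings of two polygons into a torus, sorted by the numbers of sides. -/
noncomputable def torusEquiv (N : ℕ) : {P : PolygonGluing N 2 // P.HasGenus 1} ≃
    Σ s : {s // s ∈ Finset.Nat.antidiagonalTuple 2 (2 * N)},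
      {α // (∀ i, 0 < s.1 i) ∧ α ∈ (matchings Finset.univ).filter fun α =>
        ¬ PreservesPolygons s.1 α ∧ s.1 0 + s.1 1 = 2 * numCycles (sideRotation s.1 * α) + 4} where
  toFun P := ⟨⟨P.1.sides, Finset.Nat.mem_antidiagonalTuple.2 P.1.sum_sides⟩, P.1.glue, P.1.sides_pos,
    Finset.mem_filter.2 ⟨mem_matchings.2 ⟨P.1.glue_glue, fun x =>
      iff_of_true (P.1.glue_ne x) (Finset.mem_univ x)⟩, P.1.hasGenus_one_iff.1 P.2⟩⟩
  invFun x := ⟨⟨x.1.1, x.2.2.1, Finset.Nat.mem_antidiagonalTuple.1 x.1.2, x.2.1,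
    (mem_matchings.1 (Finset.mem_filter.1 x.2.2.2).1).1,
    fun e => ((mem_matchings.1 (Finset.mem_filter.1 x.2.2.2).1).2 e).2 (Finset.mem_univ e)⟩,
    (hasGenus_one_iff _).2 (Finset.mem_filter.1 x.2.2.2).2⟩
  left_inv _ := rfl
  right_inv _ := rfl

theorem card_hasGenus_one (N : ℕ) :
    (Nat.card {P : PolygonGluing N 2 // P.HasGenus 1} : ℚ) =
      PowerSeries.coeff (2 * N) (Correlator.diagSeries Correlator.torusTwo) := by
  classical
  rw [Nat.card_congr (torusEquiv N), Nat.card_sigma, Nat.cast_sum,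
    Finset.sum_coe_sort (Finset.Nat.antidiagonalTuple 2 (2 * N)) fun s => ((Nat.card {α //
      (∀ i, 0 < s i) ∧ α ∈ (matchings Finset.univ).filter fun α => ¬ PreservesPolygons s α ∧
        s 0 + s 1 = 2 * numCycles (sideRotation s * α) + 4} : ℕ) : ℚ)]
  have key : ∀ s : Fin 2 → ℕ, ((Nat.card {α //
      (∀ i, 0 < s i) ∧ α ∈ (matchings Finset.univ).filter fun α => ¬ PreservesPolygons s α ∧
        s 0 + s 1 = 2 * numCycles (sideRotation s * α) + 4} : ℕ) : ℚ) =
      PowerSeries.coeff (s 0) (Correlator.torusTwo (s 1)) := by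
    intro s
    by_cases hs : ∀ i, 0 < s i
    · rw [← Correlator.card_matchings_eq_coeff_torusTwo hs, ← Fintype.card_coe,
        ← Nat.card_eq_fintype_card]
      congr 1
      exact Nat.card_congr (Equiv.subtypeEquivRight fun α => and_iff_right hs)
    -- The antidiagonal also contains distributions with an empty polygon: no gluing has one, and
    -- the coefficients of `torusTwo` vanish there.
    · have : IsEmpty {α // (∀ i, 0 < s i) ∧ α ∈ (matchings Finset.univ).filter fun α =>
          ¬ PreservesPolygons s α ∧ s 0 + s 1 = 2 * numCycles (sideRotation s * α) + 4} :=
        ⟨fun α => hs α.2.1⟩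
      rw [Nat.card_of_isEmpty, Nat.cast_zero]
      rw [Fin.forall_fin_two, not_and_or, not_lt, not_lt, nonpos_iff_eq_zero,
        nonpos_iff_eq_zero] at hs
      rcases hs with h | h
      · rw [h, Correlator.coeff_zero_torusTwo]
      · rw [h, Correlator.torusTwo_zero, map_zero]
  rw [Finset.sum_congr rfl fun s _ => key s, Finset.Nat.antidiagonalTuple_two, Finset.sum_map,
    Correlator.diagSeries, PowerSeries.coeff_mk]
  rfl

end PolygonGluing

theorem theorem8 (N : ℕ) (hN : 1 ≤ N) :
    (gluingNumber 1 N 2 : ℚ) =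
      (4 : ℚ) ^ ((N : ℤ) - 4) *
        ((N : ℚ) * ((N : ℚ) - 1) * ((N : ℚ) - 2) * (13 * (N : ℚ) + 3) / 3) := by
  rw [gluingNumber, if_neg (by omega), PolygonGluing.card_hasGenus_one,
    Correlator.coeff_diagSeries_torusTwo Correlator.coeff_planarTwo_comm N hN]
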